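/- Partitions are identified with their Young diagrams in English notation, rows and columns being numbered from $0$. A skew shape $\chi=\lambda/\mu$ is a pair of partitions with $\mu\subseteq\lambda$; its squares are those of $\lambda$ that are not in $\mu$. Let $\mathrm{Tab}(\chi)$ be the set of semistandard tableaux of shape $\chi$: fillings of the squares of $\chi$ by entries in $\mathbb N=\{0,1,2,\dots\}$ that increase weakly along rows and strictly down columns. The weight $\mathrm{wt}\,T\in\mathbb N^{(\mathbb N)}$ of $T$ has as component $k$ the number of entries of $T$ equal to $k$; a partition is identified with the sequence of its row lengths. A tableau is a Littlewood–Richardson tableau if in every prefix of the word obtained by reading its rows from top to bottom, each from right to left, there are for every $k\in\mathbb N$ at least as many letters $k$ as letters $k+1$. Let $\mathrm{LR}(\chi,\nu)$ be the set of Littlewood–Richardson tableaux in $\mathrm{Tab}(\chi)$ of weight $\nu$. The canonical tableau $\mathbf 1_\nu\in\mathrm{Tab}(\nu/0)$ has all entries in row $i$ equal to $i$, for every $i$. An inward jeu de taquin slide on $T\in\mathrm{Tab}(\lambda/\mu)$ starts with a corner $s$ of $\mu$ as empty square; as long as there is an entry immediately below or immediately to the right of the empty square, the smaller of these entries (the one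 below, in case of equality) moves into the empty square, and the square it leaves becomes the empty square. If $t$ is the final empty square, the result is a tableau of shape $(\lambda\setminus\{t\})/(\mu\setminus\{s\})$. Write $T\rhd T'$ if $T'$ is obtained from $T$ by a finite, possibly empty, sequence of inward slides. Let $s_\chi=\sum_{T\in\mathrm{Tab}(\chi)}X^{\mathrm{wt}\,T}$ be the skew Schur function in the variables $X_0,X_1,\dots$, and put $s_\nu=s_{\nu/0}$. **Corollary.** 1. If $T\rhd T'$, then $T$ is a Littlewood–Richardson tableau if and only if $T'$ is one. 2. For every $L\in\mathrm{Tab}(\chi)$ there are a partition $\nu$ and a tableau $P\in\mathrm{Tab}(\nu/0)$ with $L\rhd P$. For all such $\nu$ and $P$, $L$ is a Littlewood–Richardson tableau if and only if $P=\mathbf 1_\nu$, and in that case $\mathrm{wt}\,L=\nu$. 3. (Fibre equation) For every skew shape $\chi$ and every partition $\nu$, $$\{\,L\in\mathrm{Tab}(\chi) : L\rhd\mathbf 1_\nu\,\}=\mathrm{LR}(\chi,\nu).$$ 4. (Littlewood–Richardson rule) For every skew shape $\chi$ and all partitions $\lambda,\mu$, $$s_\chi=\sum_{\nu}\#\mathrm{LR}(\chi,\nu)\,s_\nu,\qquad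 s_\lambda s_\mu=\sum_{\nu\supseteq\lambda}\#\mathrm{LR}(\nu/\lambda,\mu)\,s_\nu,$$ where $\nu$ runs over partitions, all the sets $\mathrm{LR}(\cdot,\cdot)$ are finite, and only finitely many terms of each sum are non-zero. -/

import Mathlib

namespace LRRule

/-- A skew shape `outer / inner`; partitions are Young diagrams in English notation, a square
`(i, j)` lying in row `i` and column `j`, both counted from `0`. -/
structure SkewShape where
  outer : YoungDiagram
  inner : YoungDiagram
  le : inner ≤ outer

/-- The set of squares of a skew shape. -/
def SkewShape.cells (χ : SkewShape) : Finset (ℕ × ℕ) := χ.outer.cells \ χ.inner.cells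

/-- The partition shape `ν / 0`. -/
def SkewShape.ofPartition (ν : YoungDiagram) : SkewShape := ⟨ν, ⊥, bot_le⟩

/-- Semistandard tableaux of skew shape `χ`, with entries in `ℕ`: rows increase weakly and columns
increase strictly. The value of `entry` outside the shape is `0`, by convention. -/
@[ext]
structure Tab (χ : SkewShape) where
  entry : ℕ → ℕ → ℕ
  row_weak : ∀ {i j₁ j₂ : ℕ}, j₁ < j₂ → (i, j₁) ∈ χ.cells → (i, j₂) ∈ χ.cells →
    entry i j₁ ≤ entry i j₂
  col_strict : ∀ {i₁ i₂ j : ℕ}, i₁ < i₂ → (i₁, j) ∈ χ.cells → (i₂, j) ∈ χ.cells →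
    entry i₁ j < entry i₂ j
  zeros : ∀ {i j : ℕ}, (i, j) ∉ χ.cells → entry i j = 0

/-- The weight of a tableau: its component `k` is the number of entries equal to `k`. -/
noncomputable def Tab.wt {χ : SkewShape} (T : Tab χ) : ℕ →₀ ℕ :=
  ∑ c ∈ χ.cells, Finsupp.single (T.entry c.1 c.2) 1

/-- The canonical tableau of partition shape `ν`: all entries in row `i` are equal to `i`. -/
def canonical (ν : YoungDiagram) : Tab (SkewShape.ofPartition ν) where
  entry i j := if (i, j) ∈ (SkewShape.ofPartition ν).cells then i else 0
  row_weak := by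
    intro i j₁ j₂ _ h₁ h₂
    rw [if_pos h₁, if_pos h₂]
  col_strict := by
    intro i₁ i₂ j h h₁ h₂
    rwa [if_pos h₁, if_pos h₂]
  zeros := by
    intro i j h
    rw [if_neg h]

/-! ### Littlewood-Richardson tableaux -/

/-- The number of entries `k` of `T` among the squares that are read no later than `(r, c)` when
the rows are read from top to bottom and each row from right to left. -/
def Tab.prefixCount {χ : SkewShape} (T : Tab χ) (r c k : ℕ) : ℕ :=
  (χ.cells.filter fun p =>
    (p.1 < r ∨ (p.1 = r ∧ c ≤ p.2)) ∧ T.entry p.1 p.2 = k).card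

/-- Littlewood-Richardson tableaux: the word obtained by reading the rows from top to bottom, each
from right to left, is a lattice word, i.e. every prefix has at least as many letters `k` as
letters `k + 1`, for every `k`. -/
def Tab.IsLR {χ : SkewShape} (T : Tab χ) : Prop :=
  ∀ r c k : ℕ, T.prefixCount r c (k + 1) ≤ T.prefixCount r c k

/-- The set of Littlewood-Richardson tableaux of shape `χ` and weight `ν`. -/
def LR (χ : SkewShape) (ν : YoungDiagram) : Set (Tab χ) :=
  {T | T.IsLR ∧ ∀ k, T.wt k = ν.rowLen k}

/-! ### Jeu de taquin -/

/-- A tableau as a partial filling of the plane. -/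
def Tab.filling {χ : SkewShape} (T : Tab χ) : ℕ × ℕ → Option ℕ :=
  fun c => if c ∈ χ.cells then some (T.entry c.1 c.2) else none

/-- One move of an inward slide, on partial fillings with a marked empty square `(i, j)`: among
the entries just below and just to the right of the empty square, the smaller one moves into it
(the one below, when they are equal), and the square it leaves becomes the empty square. -/
inductive SlideStep : (ℕ × ℕ → Option ℕ) × (ℕ × ℕ) → (ℕ × ℕ → Option ℕ) × (ℕ × ℕ) → Prop
  | up (f : ℕ × ℕ → Option ℕ) (i j b : ℕ) (hb : f (i + 1, j) = some b)
      (hr : ∀ r, f (i, j + 1) = some r → b ≤ r) :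
      SlideStep (f, (i, j))
        (Function.update (Function.update f (i, j) (some b)) (i + 1, j) none, (i + 1, j))
  | left (f : ℕ × ℕ → Option ℕ) (i j r : ℕ) (hr : f (i, j + 1) = some r)
      (hb : ∀ b, f (i + 1, j) = some b → r < b) :
      SlideStep (f, (i, j))
        (Function.update (Function.update f (i, j) (some r)) (i, j + 1) none, (i, j + 1))

/-- `T'` is obtained from `T` by an inward jeu de taquin slide: a corner `s` of the inner partition
is made the empty square, moves are made until none is possible any more, and the final position
`t` of the empty square is removed from the outer partition. -/
def InwardSlide {χ χ' : SkewShape} (T : Tab χ) (T' : Tab χ') : Prop :=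
  ∃ s t : ℕ × ℕ,
    s ∈ χ.inner.cells ∧ χ'.inner.cells = χ.inner.cells.erase s ∧
    t ∈ χ.outer.cells ∧ χ'.outer.cells = χ.outer.cells.erase t ∧
    Relation.ReflTransGen SlideStep (T.filling, s) (T'.filling, t) ∧
    T'.filling (t.1 + 1, t.2) = none ∧ T'.filling (t.1, t.2 + 1) = none

/-- `T'` is obtained from `T` by a finite (possibly empty) sequence of inward slides. -/
def SlidesTo {χ χ' : SkewShape} (T : Tab χ) (T' : Tab χ') : Prop :=
  Relation.ReflTransGen (fun A B : (Σ ψ : SkewShape, Tab ψ) => InwardSlide A.2 B.2) ⟨χ, T⟩ ⟨χ', T'⟩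

/-! ### Schur functions -/

/-- The (skew) Schur function `s_χ`, the sum over all `T` in `Tab χ` of the monomials `X ^ wt T`,
in countably many variables `X 0, X 1, …`. -/
noncomputable def schur (χ : SkewShape) : MvPowerSeries ℕ ℤ :=
  fun d => (Nat.card {T : Tab χ // T.wt = d} : ℤ)

end LRRule

/-! The statements on slides and the two Littlewood–Richardson expansions are proved independently
of each other.

Slides. The lattice condition can be tested on columns, taken from right to left, instead of rows
(`Chain.rowDom_iff_colDom`, `Tab.isLR_iff_colCount`). A vertical move changes no column's content. A
horizontal move shifts one letter to the neighbouring column, and inspecting these two columns shows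
that the condition survives in both directions (`Punctured.colLattice_left`). Slides also preserve
the weight, every tableau rectifies, and on a partition shape only the canonical tableau is
Littlewood–Richardson (`isLR_iff_eq_canonical`); the fibre equation follows.

Expansions. This is the sign-reversing involution of Bender–Knuth type, in finitely many variables.
With `δ` the staircase and `a` the alternants, symmetry of the generating function gives `a_(κ+δ) *
s = ∑ a_(κ+δ+wt T)`, summed over tableaux `T`. If `T` is not dominant relative to `κ`, toggling two
letters to the left of the first violation swaps two exponents, so these terms cancel
(`Chain.alternant_mul_series_eq_sum_dominant`). For a partition shape `ν` and `κ = 0` one term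
survives, giving `a_δ * s_ν = a_(ν+δ)`. For a skew shape and `κ = 0` this yields the first expansion
after cancelling `a_δ`. For shape `μ` and `κ = λ` it expands `s_λ * s_μ` over the `λ`-dominant
tableaux of shape `μ`, and exchanging rows with letters (`Chain.companionEquiv`) turns these into
Littlewood–Richardson tableaux of shape `ν/λ` and weight `μ`. -/

namespace LRRule

/-! ### Chains of interlacing sequences

A tableau is encoded by the sequences `g k`, where `g k i` is the number of the first column of
row `i` that is not occupied by the inner shape or by an entry less than `k`. -/

/-- Interlacing chains from `b` to `t` in `n` steps, of sequences supported in `{0, …, n - 1}`. -/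
@[ext]
structure Chain (n : ℕ) (b t : ℕ → ℕ) where
  val : ℕ → ℕ → ℕ
  base : val 0 = b
  top : ∀ k, n ≤ k → val k = t
  mono : ∀ k i, val k i ≤ val (k + 1) i
  inter : ∀ k i, val (k + 1) (i + 1) ≤ val k i
  supp : ∀ i, n ≤ i → t i = 0

/-- The number of entries `k` in row `i`. -/
def mult (g : ℕ → ℕ → ℕ) (i k : ℕ) : ℕ := g (k + 1) i - g k i

/-- The number of entries `k` in the rows before row `n`. -/
def chainWt (n : ℕ) (g : ℕ → ℕ → ℕ) (k : ℕ) : ℕ := ∑ i ∈ Finset.range n, mult g i k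

/-- The number of entries `k` in columns from `j` on. -/
def colCount (n : ℕ) (g : ℕ → ℕ → ℕ) (j k : ℕ) : ℕ :=
  ∑ i ∈ Finset.range n, (max (g (k + 1) i) j - max (g k i) j)

/-- Adding to `κ` the weight of any prefix of the row reading gives a partition. -/
def RowDom (κ : ℕ → ℕ) (g : ℕ → ℕ → ℕ) : Prop :=
  ∀ i k, κ (k + 1) + ∑ i' ∈ Finset.range (i + 1), mult g i' (k + 1) ≤
    κ k + ∑ i' ∈ Finset.range i, mult g i' k

/-- Adding to `κ` the weight of any final set of columns gives a partition. -/
def ColDom (n : ℕ) (κ : ℕ → ℕ) (g : ℕ → ℕ → ℕ) : Prop :=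
  ∀ j k, κ (k + 1) + colCount n g j (k + 1) ≤ κ k + colCount n g j k

namespace Chain

variable {n : ℕ} {b t : ℕ → ℕ} (g : Chain n b t)

theorem monotone_val (i : ℕ) : Monotone fun k => g.val k i :=
  monotone_nat_of_le_succ fun k => g.mono k i

theorem antitone_val (k : ℕ) : Antitone (g.val k) :=
  antitone_nat_of_succ_le fun i => (g.mono k (i + 1)).trans (g.inter k i)

theorem inter_of_lt (k : ℕ) {i i' : ℕ} (h : i < i') : g.val (k + 1) i' ≤ g.val k i :=
  (g.antitone_val (k + 1) h).trans (g.inter k i)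

theorem le_top (k i : ℕ) : g.val k i ≤ t i := by
  have h := g.monotone_val i (le_max_left k n)
  simpa [g.top _ (le_max_right k n)] using h

theorem val_eq_zero (k : ℕ) {i : ℕ} (hi : n ≤ i) : g.val k i = 0 :=
  Nat.le_zero.1 ((g.le_top k i).trans (g.supp i hi).le)

theorem mult_eq_zero_of_row {i : ℕ} (hi : n ≤ i) (k : ℕ) : mult g.val i k = 0 := by
  simp [mult, g.val_eq_zero _ hi]

theorem mult_eq_zero_of_letter (i : ℕ) {k : ℕ} (hk : n ≤ k) : mult g.val i k = 0 := by
  simp [mult, g.top k hk, g.top (k + 1) (by omega)]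

theorem val_add_mult (k i : ℕ) : g.val k i + mult g.val i k = g.val (k + 1) i :=
  Nat.add_sub_cancel' (g.mono k i)

theorem val_eq_sum (k i : ℕ) : g.val k i = b i + ∑ k' ∈ Finset.range k, mult g.val i k' := by
  induction k with
  | zero => simp [g.base]
  | succ k ih => rw [Finset.sum_range_succ, ← add_assoc, ← ih, g.val_add_mult]

theorem colCount_zero (k : ℕ) : colCount n g.val 0 k = chainWt n g.val k := by
  simp [colCount, chainWt, mult]

theorem sum_mult_range {N : ℕ} (h : n ≤ N) (k : ℕ) :
    ∑ i ∈ Finset.range N, mult g.val i k = chainWt n g.val k := by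
  symm
  refine Finset.sum_subset (Finset.range_mono h) fun i _ hi => g.mult_eq_zero_of_row ?_ k
  simpa using hi

theorem chainWt_eq_zero {k : ℕ} (hk : n ≤ k) : chainWt n g.val k = 0 :=
  Finset.sum_eq_zero fun i _ => g.mult_eq_zero_of_letter i hk

/-- By interlacing, the letters `k` and `k + 1` in columns from `j` on fill initial sets of rows,
apart from one possibly partial row each. Both conditions therefore compare nearly the same counts.
-/
theorem rowDom_iff_colDom (κ : ℕ → ℕ) : RowDom κ g.val ↔ ColDom n κ g.val := by
  constructor
  · intro h j k
    have hex : ∃ i, g.val (k + 1) i ≤ j := ⟨n, by simp [g.val_eq_zero _ le_rfl]⟩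
    -- Rows before `r` have all their `k + 1` in the counted columns; rows after `r` have none
    -- there.
    obtain ⟨r, hr, hmin⟩ : ∃ r, g.val (k + 1) r ≤ j ∧ ∀ i < r, j < g.val (k + 1) i :=
      ⟨Nat.find hex, Nat.find_spec hex, fun i hi => by simpa using Nat.find_min hex hi⟩
    have hrn : r ≤ n := by
      by_contra hc
      have := hmin n (by omega)
      rw [g.val_eq_zero _ le_rfl] at this
      omega
    have hup : colCount n g.val j (k + 1) ≤
        ∑ i ∈ Finset.range r, mult g.val i (k + 1) + (g.val (k + 2) r - j) := by
      have h1 : colCount n g.val j (k + 1) ≤ ∑ i ∈ Finset.range (r + 1),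
          (max (g.val (k + 2) i) j - max (g.val (k + 1) i) j) := by
        refine Finset.sum_le_sum_of_ne_zero fun i _ hne => ?_
        rw [Finset.mem_range]
        by_contra hc
        have h2 := g.inter_of_lt (k + 1) (show r < i by omega)
        have h3 := g.mono (k + 1) i
        simp only [add_assoc, Nat.reduceAdd] at h2 h3 hne
        omega
      refine h1.trans ?_
      rw [Finset.sum_range_succ]
      refine add_le_add (Finset.sum_le_sum fun i hi => ?_) (by omega)
      have := hmin i (Finset.mem_range.1 hi)
      simp only [mult, add_assoc, Nat.reduceAdd]
      omega
    have hlow : ∑ i ∈ Finset.range r, (g.val (k + 1) i - max (g.val k i) j) ≤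
        colCount n g.val j k := by
      refine (Finset.sum_le_sum fun i hi => ?_).trans
        (Finset.sum_le_sum_of_subset (Finset.range_mono hrn))
      have := hmin i (Finset.mem_range.1 hi)
      omega
    have hR := h r k
    rw [Finset.sum_range_succ] at hR
    rcases r with _ | r
    · simp only [Finset.range_zero, Finset.sum_empty, mult] at hup hR
      simp only [add_assoc, Nat.reduceAdd] at hR
      omega
    -- Dominance at row `r + 1` settles the case where that row has a `k + 1` in the counted
    -- columns, dominance at row `r` the case where it has none.
    · have hR' := h r k
      rw [Finset.sum_range_succ] at hlow
      have e1 : ∑ i ∈ Finset.range r, (g.val (k + 1) i - max (g.val k i) j) =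
          ∑ i ∈ Finset.range r, mult g.val i k := by
        refine Finset.sum_congr rfl fun i hi => ?_
        have h1 := hmin (i + 1) (by have := Finset.mem_range.1 hi; omega)
        have h2 := g.inter k i
        rw [mult]
        omega
      rw [e1] at hlow
      rw [Finset.sum_range_succ (fun i => mult g.val i k)] at hR
      have h1 := hmin r (by omega)
      have h2 := g.inter k r
      have h3 := g.mono k r
      have h4 := g.mono (k + 1) (r + 1)
      simp only [mult, add_assoc, Nat.reduceAdd] at *
      omega
  · intro h i k
    -- From this column on lie all `k + 1` of the rows up to `i`, all `k` of the rows before `i`,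
    -- and no other letters of either kind.
    have hj := h (g.val (k + 1) i) k
    have hsub : ∀ N, ∀ f : ℕ → ℕ, (∀ x, n ≤ x → f x = 0) → (∀ x, N ≤ x → f x = 0) →
        ∑ x ∈ Finset.range n, f x = ∑ x ∈ Finset.range N, f x := by
      intro N f h1 h2
      rcases le_total n N with hN | hN
      · exact Finset.sum_subset (Finset.range_mono hN) fun x _ hx => h1 x (by simpa using hx)
      · exact (Finset.sum_subset (Finset.range_mono hN)
          fun x _ hx => h2 x (by simpa using hx)).symm
    have e1 : colCount n g.val (g.val (k + 1) i) (k + 1) =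
        ∑ i' ∈ Finset.range (i + 1), mult g.val i' (k + 1) := by
      rw [colCount, hsub (i + 1)]
      · refine Finset.sum_congr rfl fun x hx => ?_
        have h1 := g.antitone_val (k + 1) (Nat.lt_succ_iff.1 (Finset.mem_range.1 hx))
        have h2 := g.mono (k + 1) x
        rw [mult, max_eq_left h1, max_eq_left (h1.trans h2)]
      · intro x hx
        simp [g.val_eq_zero _ hx]
      · intro x hx
        have h1 := g.inter_of_lt (k + 1) (show i < x by omega)
        have h2 := g.mono (k + 1) x
        omega
    have e2 : colCount n g.val (g.val (k + 1) i) k =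
        ∑ i' ∈ Finset.range i, mult g.val i' k := by
      rw [colCount, hsub i]
      · refine Finset.sum_congr rfl fun x hx => ?_
        have h1 := g.inter_of_lt k (Finset.mem_range.1 hx)
        have h2 := g.mono k x
        rw [mult, max_eq_left h1, max_eq_left (h1.trans h2)]
      · intro x hx
        simp [g.val_eq_zero _ hx]
      · intro x hx
        have h1 := g.antitone_val (k + 1) hx
        have h2 := g.mono k x
        omega
    rwa [e1, e2] at hj

/-! ### Bender-Knuth involutions on initial sets of columns -/

/-- The largest value that the chain may take at `(k + 1, i)`, the other values being fixed. -/
def upper (g : ℕ → ℕ → ℕ) (k i : ℕ) : ℕ :=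
  if i = 0 then g (k + 2) 0 else min (g (k + 2) i) (g k (i - 1))

/-- The smallest value that the chain may take at `(k + 1, i)`, the other values being fixed. -/
def lower (g : ℕ → ℕ → ℕ) (k i : ℕ) : ℕ := max (g k i) (g (k + 2) (i + 1))

/-- The Bender-Knuth involution exchanging the numbers of letters `k` and `k + 1`, applied to the
columns before `j` only. -/
def toggleVal (j k : ℕ) (g : ℕ → ℕ → ℕ) (k' i : ℕ) : ℕ :=
  if k' = k + 1 then
    min (upper g k i) j + min (lower g k i) j - min (g (k + 1) i) j + (g (k + 1) i - j)
  else g k' i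

theorem toggleVal_of_ne {j k k' : ℕ} (g : ℕ → ℕ → ℕ) (i : ℕ) (h : k' ≠ k + 1) :
    toggleVal j k g k' i = g k' i := if_neg h

theorem toggleVal_self (j k : ℕ) (g : ℕ → ℕ → ℕ) (i : ℕ) :
    toggleVal j k g (k + 1) i =
      min (upper g k i) j + min (lower g k i) j - min (g (k + 1) i) j + (g (k + 1) i - j) :=
  if_pos rfl

/-- Column `j` has no entry `k`. -/
def Free (j k : ℕ) (g : ℕ → ℕ → ℕ) : Prop := ∀ i, j < g k i ∨ g (k + 1) i ≤ j

theorem le_upper (k i : ℕ) : g.val (k + 1) i ≤ upper g.val k i := by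
  have h1 := g.mono (k + 1) i
  rw [upper]
  split_ifs with h
  · subst h; exact h1
  · have h2 := g.inter_of_lt k (show i - 1 < i by omega)
    exact le_min h1 h2

theorem lower_le (k i : ℕ) : lower g.val k i ≤ g.val (k + 1) i :=
  max_le (g.mono k i) (g.inter (k + 1) i)

variable {g}

/-- No row's block of letters `k` contains column `j`, so a row is either left alone or reflected in
the interval between `lower` and the truncated `upper`. -/
theorem toggleVal_cases {j k : ℕ} (hf : Free j k g.val) (i : ℕ) :
    (j < g.val k i ∧ toggleVal j k g.val (k + 1) i = g.val (k + 1) i) ∨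
    (g.val (k + 1) i ≤ j ∧ toggleVal j k g.val (k + 1) i + g.val (k + 1) i =
      min (upper g.val k i) j + lower g.val k i) := by
  have h1 := g.le_upper k i
  have h2 := g.lower_le k i
  have h3 : g.val k i ≤ lower g.val k i := le_max_left _ _
  rw [toggleVal_self]
  rcases hf i with h | h
  · left; omega
  · right; omega

theorem toggleVal_bounds {j k : ℕ} (hf : Free j k g.val) (i : ℕ) :
    lower g.val k i ≤ toggleVal j k g.val (k + 1) i ∧
      toggleVal j k g.val (k + 1) i ≤ upper g.val k i := by
  have h1 := g.le_upper k i
  have h2 := g.lower_le k i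
  rcases toggleVal_cases hf i with h | h <;> omega

/-- The chain obtained by a Bender-Knuth involution on the columns before `j`. -/
def toggle (g : Chain n b t) (j k : ℕ) (hk : k + 1 < n) (hf : Free j k g.val) : Chain n b t where
  val := toggleVal j k g.val
  base := by
    funext i
    rw [toggleVal_of_ne _ _ (by omega), g.base]
  top k' hk' := by
    funext i
    rw [toggleVal_of_ne _ _ (by omega), g.top k' hk']
  mono k' i := by
    have hb := toggleVal_bounds hf i
    have h0 := g.mono k' i
    by_cases h1 : k' = k + 1
    · subst h1
      rw [toggleVal_of_ne _ _ (show k + 1 + 1 ≠ k + 1 by omega)]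
      refine hb.2.trans ?_
      rw [upper]
      split_ifs with hi
      · subst hi; exact le_rfl
      · exact min_le_left _ _
    · rw [toggleVal_of_ne _ _ h1]
      by_cases h2 : k' = k
      · subst h2
        exact (le_max_left _ _).trans hb.1
      · rwa [toggleVal_of_ne _ _ (show k' + 1 ≠ k + 1 by omega)]
  inter k' i := by
    have h0 := g.inter k' i
    by_cases h1 : k' = k + 1
    · subst h1
      rw [toggleVal_of_ne _ _ (show k + 1 + 1 ≠ k + 1 by omega)]
      exact (le_max_right _ _).trans (toggleVal_bounds hf i).1
    · rw [toggleVal_of_ne _ _ h1]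
      by_cases h2 : k' = k
      · subst h2
        exact (toggleVal_bounds hf (i + 1)).2.trans (by simp [upper])
      · rwa [toggleVal_of_ne _ _ (show k' + 1 ≠ k + 1 by omega)]
  supp := g.supp

theorem toggleVal_toggleVal {j k : ℕ} (hf : Free j k g.val) :
    toggleVal j k (toggleVal j k g.val) = g.val := by
  funext k' i
  by_cases h : k' = k + 1
  · subst h
    have e1 : upper (toggleVal j k g.val) k i = upper g.val k i := by
      simp [upper, toggleVal]
    have e2 : lower (toggleVal j k g.val) k i = lower g.val k i := by
      simp [lower, toggleVal]
    have h1 := g.le_upper k i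
    have h2 := g.lower_le k i
    have h3 : g.val k i ≤ lower g.val k i := le_max_left _ _
    rw [toggleVal_self, e1, e2]
    rcases toggleVal_cases hf i with h | h <;> omega
  · rw [toggleVal_of_ne _ _ h, toggleVal_of_ne _ _ h]

/-- A value that changes is at most `j` before and after. -/
theorem colCount_toggleVal {j k j' : ℕ} (hf : Free j k g.val) (hj : j ≤ j') (k' : ℕ) :
    colCount n (toggleVal j k g.val) j' k' = colCount n g.val j' k' := by
  have key : ∀ k' i, max (toggleVal j k g.val k' i) j' = max (g.val k' i) j' := by
    intro k' i
    by_cases h : k' = k + 1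
    · subst h
      have h2 := g.lower_le k i
      rcases toggleVal_cases hf i with h | h <;> omega
    · rw [toggleVal_of_ne _ _ h]
  simp only [colCount, key]

/-- `lower` in row `i` and `upper` in row `i + 1` are the maximum and minimum of the same two
numbers, so the sum over rows regroups up to boundary terms. -/
theorem sum_min_toggleVal {j k : ℕ} (hf : Free j k g.val) :
    ∑ i ∈ Finset.range n, min (toggleVal j k g.val (k + 1) i) j +
      ∑ i ∈ Finset.range n, min (g.val (k + 1) i) j =
    ∑ i ∈ Finset.range n, min (g.val (k + 2) i) j + ∑ i ∈ Finset.range n, min (g.val k i) j := by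
  have e1 : ∀ i, min (toggleVal j k g.val (k + 1) i) j + min (g.val (k + 1) i) j =
      min (upper g.val k i) j + min (lower g.val k i) j := by
    intro i
    have h1 := g.le_upper k i
    have h2 := g.lower_le k i
    have h3 : g.val k i ≤ lower g.val k i := le_max_left _ _
    rcases toggleVal_cases hf i with h | h <;> omega
  have e2 : ∀ N, ∑ i ∈ Finset.range N, min (upper g.val k i) j +
        ∑ i ∈ Finset.range N, min (lower g.val k i) j + min (upper g.val k N) j =
      ∑ i ∈ Finset.range N, min (g.val (k + 2) i) j + ∑ i ∈ Finset.range N, min (g.val k i) j +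
        min (g.val (k + 2) N) j := by
    intro N
    induction N with
    | zero => simp [upper]
    | succ N ih =>
      simp only [Finset.sum_range_succ]
      have : min (lower g.val k N) j + min (upper g.val k (N + 1)) j =
          min (g.val k N) j + min (g.val (k + 2) (N + 1)) j := by
        simp only [lower, upper, Nat.add_sub_cancel, Nat.succ_ne_zero, if_false]
        omega
      omega
  have e3 := e2 n
  have e4 : ∀ i, upper g.val k i ≤ g.val (k + 2) i := by
    intro i
    rw [upper]
    split_ifs with h
    · rw [h]
    · exact min_le_left _ _
  have e4 := e4 n
  have e5 := g.val_eq_zero (k + 2) le_rfl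
  have e6 : min (upper g.val k n) j = 0 := by omega
  rw [e5, e6] at e3
  rw [← Finset.sum_add_distrib, Finset.sum_congr rfl fun i _ => e1 i, Finset.sum_add_distrib]
  simpa using e3

theorem chainWt_add_sum_min (g : Chain n b t) (j k : ℕ) :
    chainWt n g.val k + ∑ i ∈ Finset.range n, min (g.val k i) j =
      colCount n g.val j k + ∑ i ∈ Finset.range n, min (g.val (k + 1) i) j := by
  rw [chainWt, colCount, ← Finset.sum_add_distrib, ← Finset.sum_add_distrib]
  refine Finset.sum_congr rfl fun i _ => ?_
  have := g.mono k i
  rw [mult]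
  omega

theorem chainWt_toggle_of_ne {j k k' : ℕ} (hk : k + 1 < n) (hf : Free j k g.val)
    (h1 : k' ≠ k) (h2 : k' ≠ k + 1) :
    chainWt n (g.toggle j k hk hf).val k' = chainWt n g.val k' := by
  refine Finset.sum_congr rfl fun i _ => ?_
  simp only [mult, toggle]
  rw [toggleVal_of_ne _ _ h2, toggleVal_of_ne _ _ (by omega)]

/-- Before column `j` the numbers of `k` and `k + 1` are exchanged, and from `j` on they are kept;
the form avoids truncated subtraction. -/
theorem chainWt_toggle {j k : ℕ} (hk : k + 1 < n) (hf : Free j k g.val) :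
    chainWt n (g.toggle j k hk hf).val k + colCount n g.val j (k + 1) =
      colCount n g.val j k + chainWt n g.val (k + 1) ∧
    chainWt n (g.toggle j k hk hf).val (k + 1) + colCount n g.val j k =
      colCount n g.val j (k + 1) + chainWt n g.val k := by
  have h1 := chainWt_add_sum_min (g.toggle j k hk hf) j k
  have h2 := chainWt_add_sum_min (g.toggle j k hk hf) j (k + 1)
  have h3 := chainWt_add_sum_min g j k
  have h4 := chainWt_add_sum_min g j (k + 1)
  have h5 := sum_min_toggleVal hf
  have e0 : ∀ i, (g.toggle j k hk hf).val k i = g.val k i :=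
    fun i => toggleVal_of_ne _ _ (by omega)
  have e2 : ∀ i, (g.toggle j k hk hf).val (k + 1 + 1) i = g.val (k + 2) i :=
    fun i => toggleVal_of_ne _ _ (by omega)
  have e1 : (g.toggle j k hk hf).val = toggleVal j k g.val := rfl
  have c1 := colCount_toggleVal hf (le_refl j) k
  have c2 := colCount_toggleVal hf (le_refl j) (k + 1)
  simp only [e0, e2] at h1 h2
  rw [e1] at h1 h2 ⊢
  rw [c1] at h1
  rw [c2] at h2
  simp only [add_assoc, Nat.reduceAdd] at *
  omega

/-! ### The first violation of dominance -/

theorem colCount_succ (g : Chain n b t) (j k : ℕ) :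
    colCount n g.val j k = colCount n g.val (j + 1) k +
      ((Finset.range n).filter fun i => g.val k i ≤ j ∧ j < g.val (k + 1) i).card := by
  rw [colCount, colCount, Finset.card_filter, ← Finset.sum_add_distrib]
  refine Finset.sum_congr rfl fun i _ => ?_
  have := g.mono k i
  split_ifs with h <;> omega

theorem card_column_le_one (g : Chain n b t) (j k : ℕ) :
    ((Finset.range n).filter fun i => g.val k i ≤ j ∧ j < g.val (k + 1) i).card ≤ 1 := by
  rw [Finset.card_le_one]
  intro x hx y hy
  simp only [Finset.mem_filter] at hx hy
  by_contra hne
  rcases Nat.lt_or_gt_of_ne hne with h | h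
  · have := g.inter_of_lt k h; omega
  · have := g.inter_of_lt k h; omega

/-- `j` is the last column, and then `k` the first letter, where dominance fails. -/
def FirstViolation (n : ℕ) (κ : ℕ → ℕ) (g : ℕ → ℕ → ℕ) (j k : ℕ) : Prop :=
  κ k + colCount n g j k < κ (k + 1) + colCount n g j (k + 1) ∧
  (∀ j', j < j' → ∀ k', κ (k' + 1) + colCount n g j' (k' + 1) ≤ κ k' + colCount n g j' k') ∧
  ∀ k' < k, κ (k' + 1) + colCount n g j (k' + 1) ≤ κ k' + colCount n g j k'

theorem FirstViolation.unique {κ : ℕ → ℕ} {g : ℕ → ℕ → ℕ} {j k j' k' : ℕ}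
    (h : FirstViolation n κ g j k) (h' : FirstViolation n κ g j' k') : j = j' ∧ k = k' := by
  have hj : j = j' := by
    rcases lt_trichotomy j j' with hl | hl | hl
    · have h1 := h.2.1 _ hl k'; have h2 := h'.1; omega
    · exact hl
    · have h1 := h'.2.1 _ hl k; have h2 := h.1; omega
  subst hj
  refine ⟨rfl, ?_⟩
  rcases lt_trichotomy k k' with hl | hl | hl
  · have h1 := h'.2.2 _ hl; have h2 := h.1; omega
  · exact hl
  · have h1 := h.2.2 _ hl; have h2 := h'.1; omega

/-- Beyond column `t 0` nothing is counted and `κ` itself is decreasing, so violating columns are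
bounded and there is a last one. -/
theorem exists_firstViolation {κ : ℕ → ℕ} (hκ : Antitone κ) (h : ¬ ColDom n κ g.val) :
    ∃ j k, FirstViolation n κ g.val j k := by
  classical
  let P : ℕ → Prop := fun j =>
    ∃ k, κ k + colCount n g.val j k < κ (k + 1) + colCount n g.val j (k + 1)
  have hP : ∃ j, P j := by
    simp only [ColDom, not_forall, not_le] at h
    exact h
  have hbd : ∀ j, P j → j ≤ t 0 := by
    rintro j ⟨k, hk⟩
    by_contra hj
    have h0 : colCount n g.val j (k + 1) = 0 := by
      refine Finset.sum_eq_zero fun i _ => ?_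
      have h1 := g.antitone_val (k + 1 + 1) (Nat.zero_le i)
      have h2 := g.le_top (k + 1 + 1) 0
      omega
    have := hκ (Nat.le_succ k)
    simp only [Nat.succ_eq_add_one] at this
    omega
  obtain ⟨j0, hj0⟩ := hP
  have hs := Nat.findGreatest_spec (P := P) (hbd j0 hj0) hj0
  refine ⟨Nat.findGreatest P (t 0), Nat.find hs, Nat.find_spec hs, ?_, ?_⟩
  · intro j' hj' k'
    by_contra hc
    have hPj : P j' := ⟨k', by omega⟩
    exact Nat.findGreatest_is_greatest hj' (hbd j' hPj) hPj
  · intro k' hk'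
    have := Nat.find_min hs hk'
    omega

/-- Dominance still holds one column to the right, and a column contains each letter at most once.
So column `j` contains `k + 1` but not `k`, and dominance fails by exactly one. -/
theorem FirstViolation.free {κ : ℕ → ℕ} {j k : ℕ} (h : FirstViolation n κ g.val j k) :
    Free j k g.val ∧ k + 1 < n ∧
      κ (k + 1) + colCount n g.val j (k + 1) = κ k + colCount n g.val j k + 1 := by
  have h1 := h.1
  have h2 := h.2.1 (j + 1) (by omega) k
  have c1 := colCount_succ g j k
  have c2 := colCount_succ g j (k + 1)
  have d2 := card_column_le_one g j (k + 1)
  have d1 : ((Finset.range n).filter fun i => g.val k i ≤ j ∧ j < g.val (k + 1) i).card = 0 := by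
    omega
  refine ⟨fun i => ?_, ?_, by omega⟩
  · rw [Finset.card_eq_zero, Finset.filter_eq_empty_iff] at d1
    by_cases hi : n ≤ i
    · right; simp [g.val_eq_zero _ hi]
    · have := d1 (Finset.mem_range.2 (not_le.1 hi))
      omega
  · by_contra hk
    have : colCount n g.val j (k + 1) = 0 ∧ colCount n g.val (j + 1) (k + 1) = 0 := by
      constructor <;>
        exact Finset.sum_eq_zero fun i _ => by
          rw [g.top (k + 1 + 1) (by omega), g.top (k + 1) (by omega), Nat.sub_self]
    omega

/-- The violation is detected in columns that the toggle leaves unchanged; hence toggling at the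
first violation is an involution. -/
theorem FirstViolation.toggle {κ : ℕ → ℕ} {j k : ℕ} (h : FirstViolation n κ g.val j k)
    (hf : Free j k g.val) : FirstViolation n κ (toggleVal j k g.val) j k := by
  refine ⟨?_, fun j' hj' k' => ?_, fun k' hk' => ?_⟩
  · simpa only [colCount_toggleVal hf le_rfl] using h.1
  · simpa only [colCount_toggleVal hf hj'.le] using h.2.1 j' hj' k'
  · simpa only [colCount_toggleVal hf le_rfl] using h.2.2 k' hk'

/-! ### Companion chains -/

/-- The chain with the roles of rows and letters exchanged. -/
def companionVal (κ : ℕ → ℕ) (g : ℕ → ℕ → ℕ) (i k : ℕ) : ℕ :=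
  κ k + ∑ i' ∈ Finset.range i, mult g i' k

theorem mult_companionVal (κ : ℕ → ℕ) (g : ℕ → ℕ → ℕ) (i k : ℕ) :
    mult (companionVal κ g) k i = mult g i k := by
  rw [mult, companionVal, companionVal, Finset.sum_range_succ]
  omega

/-- The companion of a dominant chain. -/
def companion (g : Chain n b t) {κ τ : ℕ → ℕ} (hτ : ∀ k, n ≤ k → τ k = 0)
    (hd : RowDom κ g.val) (hw : ∀ k, κ k + chainWt n g.val k = τ k) : Chain n κ τ where
  val := companionVal κ g.val
  base := by funext k; simp [companionVal]
  top i hi := by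
    funext k
    rw [companionVal, g.sum_mult_range hi, hw]
  mono i k := by
    rw [companionVal, companionVal, Finset.sum_range_succ]
    omega
  inter i k := hd i k
  supp := hτ

/-- Dominance and interlacing trade places: each is the other condition for the companion. -/
theorem rowDom_companion (g : Chain n b t) {κ τ : ℕ → ℕ} (hτ : ∀ k, n ≤ k → τ k = 0)
    (hd : RowDom κ g.val) (hw : ∀ k, κ k + chainWt n g.val k = τ k) :
    RowDom b (g.companion hτ hd hw).val := by
  intro k i
  simp only [companion, mult_companionVal, ← g.val_eq_sum]
  exact g.inter k i

theorem chainWt_companion (g : Chain n b t) {κ τ : ℕ → ℕ} (hτ : ∀ k, n ≤ k → τ k = 0)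
    (hd : RowDom κ g.val) (hw : ∀ k, κ k + chainWt n g.val k = τ k) (i : ℕ) :
    b i + chainWt n (g.companion hτ hd hw).val i = t i := by
  simp only [companion, chainWt, mult_companionVal, ← g.val_eq_sum, g.top n le_rfl]

theorem companionVal_companionVal (g : Chain n b t) (κ : ℕ → ℕ) :
    companionVal b (companionVal κ g.val) = g.val := by
  funext k i
  rw [companionVal]
  simp only [mult_companionVal, ← g.val_eq_sum]

/-- Dominant chains with prescribed ends and weight correspond to dominant chains where ends and
weight are exchanged. -/
def companionEquiv (n : ℕ) (b t κ τ : ℕ → ℕ) (ht : ∀ i, n ≤ i → t i = 0)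
    (hτ : ∀ k, n ≤ k → τ k = 0) :
    {g : Chain n b t // RowDom κ g.val ∧ ∀ k, κ k + chainWt n g.val k = τ k} ≃
      {g : Chain n κ τ // RowDom b g.val ∧ ∀ k, b k + chainWt n g.val k = t k} where
  toFun g := ⟨g.1.companion hτ g.2.1 g.2.2, g.1.rowDom_companion hτ g.2.1 g.2.2,
    g.1.chainWt_companion hτ g.2.1 g.2.2⟩
  invFun g := ⟨g.1.companion ht g.2.1 g.2.2, g.1.rowDom_companion ht g.2.1 g.2.2,
    g.1.chainWt_companion ht g.2.1 g.2.2⟩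
  left_inv g := Subtype.ext (Chain.ext (g.1.companionVal_companionVal κ))
  right_inv g := Subtype.ext (Chain.ext (g.1.companionVal_companionVal b))

/-! ### Finiteness -/

instance (n : ℕ) (b t : ℕ → ℕ) : Finite (Chain n b t) := by
  let f : Chain n b t → (k : Fin n) → (i : Fin n) → Fin (t i + 1) :=
    fun g k i => ⟨g.val k i, Nat.lt_succ_of_le (g.le_top k i)⟩
  refine Finite.of_injective f fun g g' h => Chain.ext ?_
  funext k i
  by_cases hi : n ≤ i
  · rw [g.val_eq_zero _ hi, g'.val_eq_zero _ hi]
  by_cases hk : n ≤ k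
  · rw [g.top k hk, g'.top k hk]
  have := congrFun (congrFun h ⟨k, not_le.1 hk⟩) ⟨i, not_le.1 hi⟩
  simpa [f] using this

end Chain
open Equiv

/-! ### Alternants -/

section Alternants

variable {n : ℕ}

/-- The monomial with exponents `α` in `n` variables. -/
noncomputable def expMonomial (α : Fin n → ℕ) : MvPowerSeries (Fin n) ℤ :=
  MvPowerSeries.monomial (Finsupp.equivFunOnFinite.symm α) 1

theorem expMonomial_mul (α β : Fin n → ℕ) : expMonomial α * expMonomial β = expMonomial (α + β) := by
  rw [expMonomial, expMonomial, expMonomial, MvPowerSeries.monomial_mul_monomial, one_mul]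
  have h : Finsupp.equivFunOnFinite.symm α + Finsupp.equivFunOnFinite.symm β =
      Finsupp.equivFunOnFinite.symm (α + β) := by
    ext x
    rfl
  rw [h]

theorem coeff_expMonomial (α : Fin n → ℕ) (d : Fin n →₀ ℕ) :
    MvPowerSeries.coeff d (expMonomial α) = if ⇑d = α then 1 else 0 := by
  rw [expMonomial, MvPowerSeries.coeff_monomial]
  refine if_congr ?_ rfl rfl
  rw [← Finsupp.equivFunOnFinite.apply_eq_iff_eq, Equiv.apply_symm_apply]
  rfl

/-- The alternant with exponents `α`. -/
noncomputable def alternant (α : Fin n → ℕ) : MvPowerSeries (Fin n) ℤ :=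
  ∑ w : Perm (Fin n), (Perm.sign w : ℤ) • expMonomial (α ∘ w)

theorem alternant_comp (α : Fin n → ℕ) (s : Perm (Fin n)) :
    alternant (α ∘ s) = (Perm.sign s : ℤ) • alternant α := by
  rw [alternant, alternant, Finset.smul_sum]
  refine Fintype.sum_equiv (Equiv.mulLeft s) _ _ fun w => ?_
  rw [Equiv.coe_mulLeft, Perm.sign_mul, Perm.coe_mul, smul_smul, Function.comp_assoc]
  congr 1
  rcases Int.units_eq_one_or (Perm.sign s) with h | h <;> simp [h]

/-- The staircase sequence `n - 1, …, 1, 0`. -/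
def staircase (n : ℕ) (x : Fin n) : ℕ := n - 1 - x

theorem staircase_injective : Function.Injective (staircase n) := by
  intro x y h
  simp only [staircase] at h
  ext
  omega

/-- The staircase has distinct entries, so its own monomial arises from the identity permutation
only. -/
theorem alternant_staircase_ne_zero : alternant (staircase n) ≠ 0 := by
  intro h
  have h1 := congrArg (MvPowerSeries.coeff (Finsupp.equivFunOnFinite.symm (staircase n))) h
  rw [alternant, map_sum, Finset.sum_eq_single 1] at h1
  · simp [coeff_expMonomial] at h1
  · intro w _ hw
    rw [map_smul, coeff_expMonomial, if_neg, smul_zero]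
    intro hc
    refine hw (Equiv.ext fun x => staircase_injective ?_)
    exact (congrFun hc x).symm
  · simp

end Alternants

/-! ### Generating functions of chains -/

namespace Chain

variable {n : ℕ} {b t : ℕ → ℕ}

noncomputable instance (n : ℕ) (b t : ℕ → ℕ) : Fintype (Chain n b t) := Fintype.ofFinite _

/-- The weight of a chain, as exponents of the first `n` variables. -/
def wt (g : Chain n b t) (x : Fin n) : ℕ := chainWt n g.val x

/-- The generating function of the chains from `b` to `t` by weight. -/
noncomputable def series (n : ℕ) (b t : ℕ → ℕ) : MvPowerSeries (Fin n) ℤ :=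
  ∑ g : Chain n b t, expMonomial g.wt

theorem free_top (g : Chain n b t) (k : ℕ) : Free (t 0) k g.val := fun i =>
  Or.inr ((g.antitone_val (k + 1) (Nat.zero_le i)).trans (g.le_top (k + 1) 0))

theorem colCount_top (g : Chain n b t) (k : ℕ) : colCount n g.val (t 0) k = 0 :=
  Finset.sum_eq_zero fun i _ => by
    have h1 := g.antitone_val (k + 1) (Nat.zero_le i)
    have h2 := g.le_top (k + 1) 0
    omega

theorem wt_toggle_top (g : Chain n b t) {x y : Fin n} (hxy : (y : ℕ) = x + 1)
    (hx : (x : ℕ) + 1 < n) :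
    (g.toggle (t 0) x hx (g.free_top x)).wt = g.wt ∘ swap x y := by
  have h := chainWt_toggle hx (g.free_top x)
  rw [g.colCount_top, g.colCount_top] at h
  funext z
  simp only [wt, Function.comp]
  by_cases h1 : z = x
  · subst h1
    rw [swap_apply_left, hxy]
    omega
  by_cases h2 : z = y
  · subst h2
    rw [swap_apply_right, hxy]
    omega
  rw [swap_apply_of_ne_of_ne h1 h2]
  refine chainWt_toggle_of_ne hx _ (fun hc => h1 (Fin.ext hc)) fun hc => h2 (Fin.ext ?_)
  omega

/-- This is the symmetry of the generating function: toggling all columns realises adjacent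
transpositions, which generate the symmetric group. -/
theorem sum_wt_comp {M : Type*} [AddCommMonoid M] (w : Perm (Fin n)) (F : (Fin n → ℕ) → M) :
    ∑ g : Chain n b t, F (g.wt ∘ w) = ∑ g : Chain n b t, F g.wt := by
  obtain _ | n := n
  · simp [Subsingleton.elim w 1]
  have hw : w ∈ Submonoid.closure (Set.range fun i : Fin n => swap i.castSucc i.succ) := by
    rw [Perm.mclosure_swap_castSucc_succ]
    trivial
  induction hw using Submonoid.closure_induction generalizing F with
  | mem w hw =>
    obtain ⟨i, rfl⟩ := hw
    have hx : (i.castSucc : ℕ) + 1 < n + 1 := by simp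
    have hxy : (i.succ : ℕ) = (i.castSucc : ℕ) + 1 := by simp
    let φ : Chain (n + 1) b t → Chain (n + 1) b t :=
      fun g => g.toggle (t 0) i.castSucc hx (g.free_top _)
    have hφ : Function.Involutive φ :=
      fun g => Chain.ext (toggleVal_toggleVal (g.free_top _))
    refine Fintype.sum_equiv hφ.toPerm _ _ fun g => ?_
    rw [← g.wt_toggle_top hxy hx]
    rfl
  | one => simp
  | mul x y _ _ hx hy =>
    have := hx fun α => F (α ∘ y)
    simp only [Function.comp_assoc, ← Perm.coe_mul] at this
    rw [this, hy]

/-- In the term of a permutation `w`, symmetry allows the weights to be permuted by `w` too. -/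
theorem alternant_mul_series (α : Fin n → ℕ) :
    alternant α * series n b t = ∑ g : Chain n b t, alternant (α + g.wt) := by
  simp only [alternant]
  rw [Finset.sum_comm, Finset.sum_mul]
  refine Finset.sum_congr rfl fun w _ => ?_
  rw [series, smul_mul_assoc, Finset.mul_sum, ← Finset.smul_sum,
    ← sum_wt_comp w fun β => expMonomial (α ∘ w) * expMonomial β]
  congr 1
  refine Finset.sum_congr rfl fun g _ => ?_
  rw [expMonomial_mul]
  rfl

/-- The exponents of the alternant attached to a chain. -/
def exponent (κ : ℕ → ℕ) (g : Chain n b t) : Fin n → ℕ :=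
  (fun x : Fin n => κ x + staircase n x) + g.wt

/-- The staircase drops by one from `k` to `k + 1`, which offsets the excess of one at the
violation. So the two exponents agree apart from the columns before `j`, whose contributions the
toggle exchanges. -/
theorem exponent_toggle {κ : ℕ → ℕ} {g : Chain n b t} {j k : ℕ} (h : FirstViolation n κ g.val j k)
    (hk : k + 1 < n) :
    exponent κ (g.toggle j k hk h.free.1) =
      exponent κ g ∘ swap ⟨k, by omega⟩ ⟨k + 1, hk⟩ := by
  obtain ⟨hf, -, heq⟩ := h.free
  have hw := chainWt_toggle hk hf
  funext z
  simp only [exponent, wt, Function.comp, Pi.add_apply, staircase]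
  by_cases h1 : z = ⟨k, by omega⟩
  · subst h1
    rw [swap_apply_left]
    dsimp only
    omega
  by_cases h2 : z = ⟨k + 1, hk⟩
  · subst h2
    rw [swap_apply_right]
    dsimp only
    omega
  rw [swap_apply_of_ne_of_ne h1 h2, chainWt_toggle_of_ne hk hf (fun hc => h1 (Fin.ext hc))
    fun hc => h2 (Fin.ext hc)]

theorem alternant_exponent_toggle {κ : ℕ → ℕ} {g : Chain n b t} {j k : ℕ}
    (h : FirstViolation n κ g.val j k) (hk : k + 1 < n) :
    alternant (exponent κ (g.toggle j k hk h.free.1)) = - alternant (exponent κ g) := by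
  rw [exponent_toggle h, alternant_comp, Perm.sign_swap]
  · simp
  · simp

theorem alternant_mul_series_eq_sum_dominant {κ : ℕ → ℕ} (hκ : Antitone κ)
    [DecidablePred fun g : Chain n b t => ColDom n κ g.val] :
    alternant (fun x : Fin n => κ x + staircase n x) * series n b t =
      ∑ g : Chain n b t with ColDom n κ g.val, alternant (exponent κ g) := by
  rw [alternant_mul_series]
  change ∑ g : Chain n b t, alternant (exponent κ g) = _
  rw [← Finset.sum_filter_add_sum_filter_not Finset.univ
    (fun g : Chain n b t => ColDom n κ g.val), add_eq_left]
  have hex : ∀ g ∈ Finset.univ.filter (fun g : Chain n b t => ¬ ColDom n κ g.val),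
      ∃ g' : Chain n b t, ∃ j k, ∃ h : FirstViolation n κ g.val j k,
        g' = g.toggle j k h.free.2.1 h.free.1 := by
    intro g hg
    obtain ⟨j, k, h⟩ := exists_firstViolation hκ (Finset.mem_filter.1 hg).2
    exact ⟨_, j, k, h, rfl⟩
  choose! φ hφ using hex
  have hneg : ∀ g ∈ Finset.univ.filter (fun g : Chain n b t => ¬ ColDom n κ g.val),
      alternant (exponent κ (φ g)) = - alternant (exponent κ g) := by
    intro g hg
    obtain ⟨j, k, h, e⟩ := hφ g hg
    rw [e]
    exact alternant_exponent_toggle h _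
  have hmem : ∀ g ∈ Finset.univ.filter (fun g : Chain n b t => ¬ ColDom n κ g.val),
      φ g ∈ Finset.univ.filter (fun g : Chain n b t => ¬ ColDom n κ g.val) := by
    intro g hg
    obtain ⟨j, k, h, e⟩ := hφ g hg
    refine Finset.mem_filter.2 ⟨Finset.mem_univ _, fun hc => ?_⟩
    have h1 := (h.toggle h.free.1).1
    rw [e] at hc
    exact absurd (hc j k) (not_le.2 h1)
  refine Finset.sum_involution (fun g _ => φ g) (fun g hg => ?_) (fun g hg hne hc => ?_) hmem
    fun g hg => ?_
  · rw [hneg g hg, add_neg_cancel]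
  -- The alternant of a fixed point equals its own negative, hence vanishes over `ℤ`.
  · have h1 := hneg g hg
    rw [hc] at h1
    refine hne (MvPowerSeries.ext fun d => ?_)
    have h2 := congrArg (MvPowerSeries.coeff d) h1
    rw [map_neg] at h2
    rw [map_zero]
    omega
  · obtain ⟨j, k, h, e⟩ := hφ g hg
    obtain ⟨j', k', h', e'⟩ := hφ (φ g) (hmem g hg)
    have h1 : FirstViolation n κ (φ g).val j k := by
      rw [e]
      exact h.toggle h.free.1
    obtain ⟨rfl, rfl⟩ := h1.unique h'
    rw [e']
    refine Chain.ext ?_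
    change toggleVal j k (φ g).val = g.val
    rw [e]
    exact toggleVal_toggleVal h.free.1

/-! ### Chains starting from the empty partition -/

theorem val_eq_zero_of_le (g : Chain n 0 t) {k i : ℕ} (h : k ≤ i) : g.val k i = 0 := by
  induction k generalizing i with
  | zero => rw [g.base]; rfl
  | succ k ih =>
    obtain ⟨i, rfl⟩ : ∃ i', i = i' + 1 := ⟨i - 1, by omega⟩
    exact Nat.le_zero.1 ((g.inter k i).trans (ih (by omega)).le)

/-- A letter `k` in row `i` needs a letter `k - 1` in an earlier row, so each row can introduce at
most one new letter. -/
theorem RowDom.mult_eq_zero {g : ℕ → ℕ → ℕ} (h : RowDom 0 g) {i k : ℕ} (hik : i < k) :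
    mult g i k = 0 := by
  induction i using Nat.strong_induction_on generalizing k with
  | _ i ih =>
    obtain ⟨k, rfl⟩ : ∃ k', k = k' + 1 := ⟨k - 1, by omega⟩
    have h1 := h i k
    rw [Finset.sum_range_succ, Finset.sum_eq_zero (s := Finset.range i) fun i' hi' =>
      ih i' (Finset.mem_range.1 hi') (show i' < k by have := Finset.mem_range.1 hi'; omega)] at h1
    simp only [Pi.zero_apply] at h1
    omega

theorem val_eq_of_rowDom (g : Chain n 0 t) (h : RowDom 0 g.val) (k i : ℕ) :
    g.val k i = if i < k then t i else 0 := by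
  split_ifs with hik
  · have hconst : ∀ m, g.val (k + m) i = g.val k i := by
      intro m
      induction m with
      | zero => rfl
      | succ m ih =>
        have h1 := RowDom.mult_eq_zero h (show i < k + m by omega)
        have h2 := g.val_add_mult (k + m) i
        rw [← add_assoc, ← h2, h1, ih, add_zero]
    rw [← hconst n, g.top _ (Nat.le_add_left n k)]
  · exact g.val_eq_zero_of_le (not_lt.1 hik)

/-- The chain of the canonical tableau. -/
def canonicalChain (ht : Antitone t) (hs : ∀ i, n ≤ i → t i = 0) : Chain n 0 t where
  val k i := if i < k then t i else 0
  base := by funext i; simp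
  top k hk := by
    funext i
    split_ifs with h
    · rfl
    · exact (hs i (by omega)).symm
  mono k i := by split_ifs <;> omega
  inter k i := by
    have := ht (Nat.le_succ i)
    simp only [Nat.succ_eq_add_one] at this
    split_ifs <;> omega
  supp := hs

theorem mult_canonicalChain (ht : Antitone t) (hs : ∀ i, n ≤ i → t i = 0) (i k : ℕ) :
    mult (canonicalChain ht hs).val i k = if i = k then t k else 0 := by
  simp only [mult, canonicalChain]
  by_cases h : i = k
  · subst h; simp
  · split_ifs <;> omega

theorem rowDom_canonicalChain (ht : Antitone t) (hs : ∀ i, n ≤ i → t i = 0) :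
    RowDom 0 (canonicalChain ht hs).val := by
  intro i k
  simp only [mult_canonicalChain, Finset.sum_ite_eq', Finset.mem_range, Pi.zero_apply, zero_add]
  have := ht (Nat.le_succ k)
  simp only [Nat.succ_eq_add_one] at this
  split_ifs <;> omega

theorem chainWt_canonicalChain (ht : Antitone t) (hs : ∀ i, n ≤ i → t i = 0) (k : ℕ) :
    chainWt n (canonicalChain ht hs).val k = t k := by
  simp only [chainWt, mult_canonicalChain, Finset.sum_ite_eq', Finset.mem_range]
  split_ifs with h
  · rfl
  · exact (hs k (not_lt.1 h)).symm

/-- The bialternant formula: for `κ = 0` the canonical chain is the only dominant one. -/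
theorem alternant_mul_straight_series (ht : Antitone t) (hs : ∀ i, n ≤ i → t i = 0) :
    alternant (staircase n) * series n 0 t =
      alternant (fun x : Fin n => t x + staircase n x) := by
  classical
  have h := alternant_mul_series_eq_sum_dominant (n := n) (b := 0) (t := t) (κ := 0)
    antitone_const
  have hu : (Finset.univ.filter fun g : Chain n 0 t => ColDom n 0 g.val) =
      {canonicalChain ht hs} := by
    ext g
    simp only [Finset.mem_filter, Finset.mem_univ, true_and, Finset.mem_singleton,
      ← rowDom_iff_colDom]
    constructor
    · intro hg
      refine Chain.ext ?_
      funext k i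
      exact val_eq_of_rowDom g hg k i
    · rintro rfl
      exact rowDom_canonicalChain ht hs
  rw [hu, Finset.sum_singleton] at h
  simp only [Pi.zero_apply, zero_add] at h
  refine h.trans (congrArg _ ?_)
  funext x
  simp only [exponent, wt, chainWt_canonicalChain, Pi.add_apply, Pi.zero_apply, zero_add]
  exact add_comm _ _

end Chain

/-! ### Tableaux as chains -/

theorem SkewShape.mem_cells_iff (χ : SkewShape) {i c : ℕ} :
    (i, c) ∈ χ.cells ↔ χ.inner.rowLen i ≤ c ∧ c < χ.outer.rowLen i := by
  rw [SkewShape.cells, Finset.mem_sdiff, YoungDiagram.mem_cells, YoungDiagram.mem_cells,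
    YoungDiagram.mem_iff_lt_rowLen, YoungDiagram.mem_iff_lt_rowLen, not_lt, and_comm]

theorem SkewShape.rowLen_le (χ : SkewShape) (i : ℕ) : χ.inner.rowLen i ≤ χ.outer.rowLen i := by
  by_contra h
  have h1 : (i, χ.outer.rowLen i) ∈ χ.inner := YoungDiagram.mem_iff_lt_rowLen.2 (not_le.1 h)
  have h2 : (i, χ.outer.rowLen i) ∈ χ.outer := χ.le h1
  exact lt_irrefl _ (YoungDiagram.mem_iff_lt_rowLen.1 h2)

theorem rowLen_eq_zero {ν : YoungDiagram} {i : ℕ} (h : ν.colLen 0 ≤ i) :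
    ν.rowLen i = 0 := by
  by_contra hc
  have h1 : (i, 0) ∈ ν := YoungDiagram.mem_iff_lt_rowLen.2 (Nat.pos_of_ne_zero hc)
  have h2 := YoungDiagram.mem_iff_lt_colLen.1 h1
  omega

theorem antitone_rowLen (ν : YoungDiagram) : Antitone ν.rowLen :=
  fun _ _ h => ν.rowLen_anti _ _ h

theorem eq_of_rowLen {ν ν' : YoungDiagram} (h : ∀ i, ν.rowLen i = ν'.rowLen i) :
    ν = ν' := by
  ext ⟨i, j⟩
  rw [YoungDiagram.mem_cells, YoungDiagram.mem_cells, YoungDiagram.mem_iff_lt_rowLen,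
    YoungDiagram.mem_iff_lt_rowLen, h]

theorem rowLen_bot : (⊥ : YoungDiagram).rowLen = 0 := by
  funext i
  by_contra h
  exact YoungDiagram.notMem_bot (i, 0)
    (YoungDiagram.mem_iff_lt_rowLen.2 (Nat.pos_of_ne_zero h))

namespace Tab

variable {χ : SkewShape} (T : Tab χ)

theorem exists_firstCol (k i : ℕ) :
    ∃ c, χ.inner.rowLen i ≤ c ∧ (χ.outer.rowLen i ≤ c ∨ k ≤ T.entry i c) :=
  ⟨χ.outer.rowLen i, χ.rowLen_le i, Or.inl le_rfl⟩

/-- The first column of row `i` outside the inner shape where there is no entry less than `k`. -/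
noncomputable def firstCol (k i : ℕ) : ℕ := by
  classical exact Nat.find (T.exists_firstCol k i)

theorem firstCol_spec (k i : ℕ) : χ.inner.rowLen i ≤ T.firstCol k i ∧
    (χ.outer.rowLen i ≤ T.firstCol k i ∨ k ≤ T.entry i (T.firstCol k i)) := by
  classical exact Nat.find_spec (T.exists_firstCol k i)

theorem firstCol_le {k i c : ℕ} (h1 : χ.inner.rowLen i ≤ c)
    (h2 : χ.outer.rowLen i ≤ c ∨ k ≤ T.entry i c) : T.firstCol k i ≤ c := by
  classical exact Nat.find_min' (T.exists_firstCol k i) ⟨h1, h2⟩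

theorem firstCol_le_outer (k i : ℕ) : T.firstCol k i ≤ χ.outer.rowLen i :=
  T.firstCol_le (χ.rowLen_le i) (Or.inl le_rfl)

theorem lt_firstCol_iff {k i c : ℕ} (h : (i, c) ∈ χ.cells) :
    c < T.firstCol k i ↔ T.entry i c < k := by
  have hc := χ.mem_cells_iff.1 h
  constructor
  · intro h1
    by_contra h2
    exact absurd (T.firstCol_le hc.1 (Or.inr (not_lt.1 h2))) (not_le.2 h1)
  · intro h1
    by_contra h2
    obtain ⟨h3, h4⟩ := T.firstCol_spec k i
    rcases h4 with h4 | h4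
    · omega
    · rcases Nat.lt_or_ge (T.firstCol k i) c with h5 | h5
      · have := T.row_weak h5 (χ.mem_cells_iff.2 ⟨h3, by omega⟩) h
        omega
      · have : T.firstCol k i = c := by omega
        rw [this] at h4
        omega

theorem firstCol_mono (k i : ℕ) : T.firstCol k i ≤ T.firstCol (k + 1) i := by
  obtain ⟨h1, h2⟩ := T.firstCol_spec (k + 1) i
  exact T.firstCol_le h1 (h2.imp_right fun h => by omega)

/-- Otherwise an entry at least `k` would stand directly above an entry at most `k`. -/
theorem firstCol_inter (k i : ℕ) : T.firstCol (k + 1) (i + 1) ≤ T.firstCol k i := by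
  by_contra hc
  obtain ⟨h1, h2⟩ := T.firstCol_spec k i
  have h3 := T.firstCol_le_outer (k + 1) (i + 1)
  have h4 := χ.outer.rowLen_anti i (i + 1) (by omega)
  have h5 := χ.inner.rowLen_anti i (i + 1) (by omega)
  have m1 : (i, T.firstCol k i) ∈ χ.cells := χ.mem_cells_iff.2 ⟨h1, by omega⟩
  have m2 : (i + 1, T.firstCol k i) ∈ χ.cells := χ.mem_cells_iff.2 ⟨by omega, by omega⟩
  have h6 := (T.lt_firstCol_iff m2).1 (not_le.1 hc)
  have h7 := T.col_strict (show i < i + 1 by omega) m1 m2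
  rcases h2 with h2 | h2 <;> omega

theorem firstCol_zero (i : ℕ) : T.firstCol 0 i = χ.inner.rowLen i :=
  le_antisymm (T.firstCol_le le_rfl (Or.inr (Nat.zero_le _))) (T.firstCol_spec 0 i).1

/-- All entries are less than `n`. -/
def Bounded (n : ℕ) : Prop := ∀ i c, (i, c) ∈ χ.cells → T.entry i c < n

variable {T} in
theorem Bounded.mono {n m : ℕ} (h : T.Bounded n) (hm : n ≤ m) : T.Bounded m :=
  fun i c hc => (h i c hc).trans_le hm

theorem exists_bounded : ∃ n, T.Bounded n := by
  refine ⟨χ.cells.sup (fun p => T.entry p.1 p.2) + 1, fun i c h => ?_⟩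
  exact Nat.lt_succ_of_le (Finset.le_sup (f := fun p : ℕ × ℕ => T.entry p.1 p.2) h)

/-- The chain of a tableau. -/
noncomputable def chain {n : ℕ} (hn : χ.outer.colLen 0 ≤ n) (hT : T.Bounded n) :
    Chain n χ.inner.rowLen χ.outer.rowLen where
  val := T.firstCol
  base := funext T.firstCol_zero
  top k hk := by
    funext i
    refine le_antisymm (T.firstCol_le_outer k i) ?_
    by_contra hc
    obtain ⟨h1, h2⟩ := T.firstCol_spec k i
    have h3 := hT i _ (χ.mem_cells_iff.2 ⟨h1, not_le.1 hc⟩)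
    omega
  mono := T.firstCol_mono
  inter := T.firstCol_inter
  supp i hi := rowLen_eq_zero (hn.trans hi)

/-! ### Weights, column counts and prefix counts in terms of the chain -/

theorem entry_eq_iff {i c k : ℕ} (h : (i, c) ∈ χ.cells) :
    T.entry i c = k ↔ T.firstCol k i ≤ c ∧ c < T.firstCol (k + 1) i := by
  rw [T.lt_firstCol_iff h, ← not_lt, T.lt_firstCol_iff h]
  omega

theorem card_filter_entry {n : ℕ} (hn : χ.outer.colLen 0 ≤ n) (k : ℕ) (Q : ℕ × ℕ → Prop)
    [DecidablePred Q] :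
    (χ.cells.filter fun p => Q p ∧ T.entry p.1 p.2 = k).card =
      ∑ i ∈ Finset.range n,
        ((Finset.Ico (T.firstCol k i) (T.firstCol (k + 1) i)).filter fun c => Q (i, c)).card := by
  rw [Finset.card_eq_sum_card_fiberwise (f := Prod.fst) (t := Finset.range n)]
  · refine Finset.sum_congr rfl fun i _ => ?_
    rw [← Finset.card_map (s := (Finset.Ico (T.firstCol k i) (T.firstCol (k + 1) i)).filter
      fun c => Q (i, c)) ⟨Prod.mk i, Prod.mk_right_injective i⟩]
    refine congrArg Finset.card ?_
    ext ⟨i', c⟩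
    simp only [Finset.mem_filter, Finset.mem_map, Finset.mem_Ico]
    constructor
    · rintro ⟨⟨h1, h2, h3⟩, rfl⟩
      exact ⟨c, ⟨(T.entry_eq_iff h1).1 h3, h2⟩, rfl⟩
    · rintro ⟨c', ⟨h1, h2⟩, he⟩
      obtain ⟨rfl, rfl⟩ : i = i' ∧ c' = c := by simpa using he
      have hm : (i, c') ∈ χ.cells := by
        have h3 := (T.firstCol_spec k i).1
        have h4 := T.firstCol_le_outer (k + 1) i
        exact χ.mem_cells_iff.2 ⟨by omega, by omega⟩
      exact ⟨⟨hm, h2, (T.entry_eq_iff hm).2 h1⟩, rfl⟩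
  · rintro ⟨i, c⟩ h
    have h1 := χ.mem_cells_iff.1 (Finset.mem_filter.1 h).1
    simp only [Finset.coe_range, Set.mem_Iio]
    by_contra hc
    rw [rowLen_eq_zero (hn.trans (not_lt.1 hc))] at h1
    omega

theorem wt_apply (k : ℕ) : T.wt k = (χ.cells.filter fun p => T.entry p.1 p.2 = k).card := by
  rw [wt, Finsupp.finsetSum_apply, Finset.card_filter]
  refine Finset.sum_congr rfl fun p _ => ?_
  rw [Finsupp.single_apply]

theorem wt_eq_chainWt {n : ℕ} (hn : χ.outer.colLen 0 ≤ n) (k : ℕ) :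
    T.wt k = chainWt n T.firstCol k := by
  have := T.card_filter_entry hn k fun _ => True
  simp only [true_and, Finset.filter_true, Nat.card_Ico] at this
  rw [wt_apply, this]
  rfl

/-- The number of entries `k` in columns from `j` on. -/
def colCount (j k : ℕ) : ℕ :=
  (χ.cells.filter fun p => j ≤ p.2 ∧ T.entry p.1 p.2 = k).card

theorem colCount_eq {n : ℕ} (hn : χ.outer.colLen 0 ≤ n) (j k : ℕ) :
    T.colCount j k = LRRule.colCount n T.firstCol j k := by
  rw [colCount, T.card_filter_entry hn k fun p => j ≤ p.2, LRRule.colCount]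
  refine Finset.sum_congr rfl fun i _ => ?_
  have : ((Finset.Ico (T.firstCol k i) (T.firstCol (k + 1) i)).filter fun c => j ≤ c) =
      Finset.Ico (max (T.firstCol k i) j) (T.firstCol (k + 1) i) := by
    ext c
    simp only [Finset.mem_filter, Finset.mem_Ico, max_le_iff]
    tauto
  have hm := T.firstCol_mono k i
  rw [this, Nat.card_Ico]
  omega

theorem prefixCount_eq {n r : ℕ} (hn : χ.outer.colLen 0 ≤ n) (hr : r < n) (c k : ℕ) :
    T.prefixCount r c k = ∑ i ∈ Finset.range r, mult T.firstCol i k +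
      (T.firstCol (k + 1) r - max (T.firstCol k r) c) := by
  rw [prefixCount, T.card_filter_entry hn k fun p => p.1 < r ∨ (p.1 = r ∧ c ≤ p.2)]
  rw [← Finset.sum_subset (Finset.range_mono (show r + 1 ≤ n from hr)), Finset.sum_range_succ]
  · congr 1
    · refine Finset.sum_congr rfl fun i hi => ?_
      simp [Finset.mem_range.1 hi, mult]
    · have : ((Finset.Ico (T.firstCol k r) (T.firstCol (k + 1) r)).filter
          fun c' => r < r ∨ (r = r ∧ c ≤ c')) =
          Finset.Ico (max (T.firstCol k r) c) (T.firstCol (k + 1) r) := by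
        ext c
        simp only [Finset.mem_filter, Finset.mem_Ico, max_le_iff, lt_irrefl, false_or, true_and]
        tauto
      rw [this, Nat.card_Ico]
  · intro i _ hi
    have h1 : ¬ i < r := by simp at hi; omega
    have h2 : ¬ i = r := by simp at hi; omega
    simp [h1, h2]

/-- Within a row larger letters are read first, so the critical prefix for `k` ends with all `k + 1`
and none of the `k` of its last row. -/
theorem isLR_iff_rowDom : T.IsLR ↔ RowDom 0 T.firstCol := by
  constructor
  · intro h i k
    have h1 := h i (T.firstCol (k + 1) i) k
    -- Row `i` may lie below the shape, so the range of rows is enlarged to contain it.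
    have hn : χ.outer.colLen 0 ≤ χ.outer.colLen 0 + i + 1 := by omega
    rw [T.prefixCount_eq hn (by omega), T.prefixCount_eq hn (by omega)] at h1
    rw [Finset.sum_range_succ]
    simp only [Pi.zero_apply, mult] at *
    omega
  · intro h r c k
    have h1 := h r k
    have hn : χ.outer.colLen 0 ≤ χ.outer.colLen 0 + r + 1 := by omega
    rw [T.prefixCount_eq hn (by omega), T.prefixCount_eq hn (by omega)]
    rw [Finset.sum_range_succ] at h1
    simp only [Pi.zero_apply, mult] at *
    omega

/-- Littlewood-Richardson tableaux are also characterised by their columns, read from right to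
left. -/
theorem isLR_iff_colCount : T.IsLR ↔ ∀ j k, T.colCount j (k + 1) ≤ T.colCount j k := by
  obtain ⟨m, hm⟩ := T.exists_bounded
  have hn : χ.outer.colLen 0 ≤ max (χ.outer.colLen 0) m := le_max_left _ _
  rw [isLR_iff_rowDom]
  have h := (T.chain hn (hm.mono (le_max_right _ _))).rowDom_iff_colDom 0
  simp only [ColDom, Pi.zero_apply, zero_add] at h
  simp only [T.colCount_eq hn]
  exact h

/-! ### Recovering a tableau from its chain -/

theorem exists_lt_chain {n : ℕ} (g : Chain n χ.inner.rowLen χ.outer.rowLen) {i c : ℕ}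
    (h : (i, c) ∈ χ.cells) : ∃ k, c < g.val (k + 1) i := by
  refine ⟨n, ?_⟩
  rw [g.top (n + 1) (by omega)]
  exact (χ.mem_cells_iff.1 h).2

open Classical in
/-- The entries of the tableau of a chain. -/
noncomputable def entryOfChain {n : ℕ} (g : Chain n χ.inner.rowLen χ.outer.rowLen) (i c : ℕ) : ℕ :=
  if h : (i, c) ∈ χ.cells then Nat.find (exists_lt_chain g h) else 0

theorem entryOfChain_lt_iff {n : ℕ} (g : Chain n χ.inner.rowLen χ.outer.rowLen) {i c : ℕ}
    (h : (i, c) ∈ χ.cells) (k : ℕ) : entryOfChain g i c < k ↔ c < g.val k i := by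
  classical
  rw [entryOfChain, dif_pos h, Nat.find_lt_iff]
  constructor
  · rintro ⟨m, hm, h1⟩
    exact h1.trans_le (g.monotone_val i hm)
  · intro h1
    rcases k with _ | k
    · rw [g.base] at h1
      exact absurd (χ.mem_cells_iff.1 h).1 (not_le.2 h1)
    · exact ⟨k, Nat.lt_succ_self k, h1⟩

/-- The tableau of a chain. -/
noncomputable def ofChain {n : ℕ} (g : Chain n χ.inner.rowLen χ.outer.rowLen) : Tab χ where
  entry := entryOfChain g
  row_weak := by
    intro i j₁ j₂ hj h₁ h₂
    rw [← Nat.lt_succ_iff, entryOfChain_lt_iff g h₁]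
    exact hj.trans ((entryOfChain_lt_iff g h₂ _).1 (Nat.lt_succ_self _))
  col_strict := by
    intro i₁ i₂ j hi h₁ h₂
    rw [entryOfChain_lt_iff g h₁]
    exact ((entryOfChain_lt_iff g h₂ _).1 (Nat.lt_succ_self _)).trans_le (g.inter_of_lt _ hi)
  zeros := by
    intro i j h
    rw [entryOfChain, dif_neg h]

theorem ofChain_entry_lt_iff {n : ℕ} (g : Chain n χ.inner.rowLen χ.outer.rowLen) {i c : ℕ}
    (h : (i, c) ∈ χ.cells) (k : ℕ) : (ofChain g).entry i c < k ↔ c < g.val k i :=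
  entryOfChain_lt_iff g h k

theorem ofChain_bounded {n : ℕ} (g : Chain n χ.inner.rowLen χ.outer.rowLen) :
    (ofChain g).Bounded n := by
  intro i c h
  rw [ofChain_entry_lt_iff g h, g.top n le_rfl]
  exact (χ.mem_cells_iff.1 h).2

theorem firstCol_ofChain {n : ℕ} (g : Chain n χ.inner.rowLen χ.outer.rowLen) :
    (ofChain g).firstCol = g.val := by
  funext k i
  have hb : χ.inner.rowLen i ≤ g.val k i := by
    have := g.monotone_val i (Nat.zero_le k)
    simpa only [g.base] using this
  have h1 := ((ofChain g).firstCol_spec k i).1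
  have h2 := (ofChain g).firstCol_le_outer k i
  have h3 := g.le_top k i
  rcases lt_trichotomy ((ofChain g).firstCol k i) (g.val k i) with h | h | h
  · have hm : (i, (ofChain g).firstCol k i) ∈ χ.cells := χ.mem_cells_iff.2 ⟨h1, by omega⟩
    have := ((ofChain g).lt_firstCol_iff hm).2 ((ofChain_entry_lt_iff g hm k).2 h)
    exact absurd this (lt_irrefl _)
  · exact h
  · have hm : (i, g.val k i) ∈ χ.cells := χ.mem_cells_iff.2 ⟨hb, by omega⟩
    have := (ofChain_entry_lt_iff g hm k).1 (((ofChain g).lt_firstCol_iff hm).1 h)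
    exact absurd this (lt_irrefl _)

theorem firstCol_injective : Function.Injective (firstCol : Tab χ → ℕ → ℕ → ℕ) := by
  intro T T' h
  ext i c
  by_cases hm : (i, c) ∈ χ.cells
  · have h1 := (T.entry_eq_iff hm).1 rfl
    rw [h] at h1
    exact ((T'.entry_eq_iff hm).2 h1).symm
  · rw [T.zeros hm, T'.zeros hm]

/-- Tableaux with entries less than `n` correspond to chains of length `n`. -/
noncomputable def chainEquiv (χ : SkewShape) {n : ℕ} (hn : χ.outer.colLen 0 ≤ n) :
    {T : Tab χ // T.Bounded n} ≃ Chain n χ.inner.rowLen χ.outer.rowLen where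
  toFun T := T.1.chain hn T.2
  invFun g := ⟨ofChain g, ofChain_bounded g⟩
  left_inv _ := Subtype.ext (firstCol_injective (firstCol_ofChain _))
  right_inv g := Chain.ext (firstCol_ofChain g)

theorem bounded_of_wt {n : ℕ} (h : ∀ k, n ≤ k → T.wt k = 0) : T.Bounded n := by
  intro i c hm
  by_contra hc
  have h1 := h _ (not_lt.1 hc)
  rw [wt_apply, Finset.card_eq_zero, Finset.filter_eq_empty_iff] at h1
  exact h1 hm rfl

variable {T} in
theorem Bounded.wt_eq_zero {n : ℕ} (h : T.Bounded n) {k : ℕ} (hk : n ≤ k) : T.wt k = 0 := by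
  rw [wt_apply, Finset.card_eq_zero, Finset.filter_eq_empty_iff]
  rintro ⟨i, c⟩ hm he
  have := h i c hm
  simp only at he
  omega

end Tab

/-! ### Moves of a slide -/

/-- `f` is a semistandard filling of the squares of `lam` outside `mu`, except for `h`. -/
structure Punctured (lam mu : YoungDiagram) (f : ℕ × ℕ → Option ℕ) (h : ℕ × ℕ) : Prop where
  mem : h ∈ lam
  notMem : h ∉ mu
  dom : ∀ p, (∃ a, f p = some a) ↔ p ∈ lam ∧ p ∉ mu ∧ p ≠ h
  row : ∀ {i j₁ j₂ a b : ℕ}, j₁ < j₂ → f (i, j₁) = some a → f (i, j₂) = some b → a ≤ b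
  col : ∀ {i₁ i₂ j a b : ℕ}, i₁ < i₂ → f (i₁, j) = some a → f (i₂, j) = some b → a < b

/-- The number of squares in `B`, in columns from `j` on, filled with `k`. -/
def fillCount (B : Finset (ℕ × ℕ)) (f : ℕ × ℕ → Option ℕ) (j k : ℕ) : ℕ :=
  (B.filter fun p => j ≤ p.2 ∧ f p = some k).card

/-- The number of squares in `B` and in column `j` filled with `k`. -/
def columnCount (B : Finset (ℕ × ℕ)) (f : ℕ × ℕ → Option ℕ) (j k : ℕ) : ℕ :=
  (B.filter fun p => p.2 = j ∧ f p = some k).card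

/-- The filling obtained when the entry `b` moves from `q` to `h`. -/
def moveEntry (f : ℕ × ℕ → Option ℕ) (h q : ℕ × ℕ) (b : ℕ) : ℕ × ℕ → Option ℕ :=
  Function.update (Function.update f h (some b)) q none

theorem moveEntry_eq_some_iff {f : ℕ × ℕ → Option ℕ} {h q : ℕ × ℕ} {b : ℕ} (hq : q ≠ h)
    (p : ℕ × ℕ) (k : ℕ) : moveEntry f h q b p = some k ↔
      (p = h ∧ b = k) ∨ (p ≠ h ∧ p ≠ q ∧ f p = some k) := by
  rw [moveEntry]
  by_cases h1 : p = q
  · subst h1; simp [hq]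
  · rw [Function.update_of_ne h1]
    by_cases h2 : p = h
    · subst h2; simp
    · rw [Function.update_of_ne h2]; simp [h1, h2]

theorem fillCount_eq_add (B : Finset (ℕ × ℕ)) (f : ℕ × ℕ → Option ℕ) (j k : ℕ) :
    fillCount B f j k = fillCount B f (j + 1) k + columnCount B f j k := by
  rw [fillCount, fillCount, columnCount, Finset.card_filter, Finset.card_filter,
    Finset.card_filter, ← Finset.sum_add_distrib]
  refine Finset.sum_congr rfl fun p _ => ?_
  by_cases h : f p = some k
  · simp only [h, and_true]
    split_ifs <;> omega
  · simp [h]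

theorem fillCount_moveEntry {B : Finset (ℕ × ℕ)} {f : ℕ × ℕ → Option ℕ} {h q : ℕ × ℕ} {b : ℕ}
    (hh : h ∈ B) (hq : q ∈ B) (hqh : q ≠ h) (fh : f h = none) (fq : f q = some b) (j k : ℕ) :
    fillCount B (moveEntry f h q b) j k + (if b = k ∧ j ≤ q.2 then 1 else 0) =
      fillCount B f j k + (if b = k ∧ j ≤ h.2 then 1 else 0) := by
  rw [fillCount, fillCount, Finset.card_filter, Finset.card_filter,
    ← Finset.add_sum_erase B _ hh, ← Finset.add_sum_erase B _ hh,
    ← Finset.add_sum_erase _ _ (Finset.mem_erase.2 ⟨hqh, hq⟩),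
    ← Finset.add_sum_erase _ _ (Finset.mem_erase.2 ⟨hqh, hq⟩)]
  have hrest : ∑ p ∈ (B.erase h).erase q,
        (if j ≤ p.2 ∧ moveEntry f h q b p = some k then 1 else 0) =
      ∑ p ∈ (B.erase h).erase q, (if j ≤ p.2 ∧ f p = some k then 1 else 0) := by
    refine Finset.sum_congr rfl fun p hp => ?_
    simp only [Finset.mem_erase] at hp
    simp [moveEntry_eq_some_iff hqh, hp.1, hp.2.1]
  rw [hrest]
  simp only [moveEntry_eq_some_iff hqh, fh, fq, Option.some.injEq, ne_eq, not_true_eq_false,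
    false_and, and_false, or_false, true_and, hqh, if_false, reduceCtorEq]
  simp only [and_comm (a := b = k)]
  omega

namespace Punctured

variable {lam mu : YoungDiagram} {f : ℕ × ℕ → Option ℕ}

theorem filled {h : ℕ × ℕ} (H : Punctured lam mu f h) {p : ℕ × ℕ} (h1 : p ∈ lam) (h2 : p ∉ mu)
    (h3 : p ≠ h) : ∃ a, f p = some a := (H.dom p).2 ⟨h1, h2, h3⟩

theorem hole_eq_none {h : ℕ × ℕ} (H : Punctured lam mu f h) : f h = none := by
  by_contra hc
  obtain ⟨a, ha⟩ := Option.ne_none_iff_exists'.1 hc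
  exact ((H.dom h).1 ⟨a, ha⟩).2.2 rfl

theorem mem_of_eq_some {h p : ℕ × ℕ} (H : Punctured lam mu f h) {a : ℕ} (hp : f p = some a) :
    p ∈ lam ∧ p ∉ mu ∧ p ≠ h := (H.dom p).1 ⟨a, hp⟩

theorem dom_moveEntry {h q : ℕ × ℕ} {b : ℕ} (H : Punctured lam mu f h) (hq : f q = some b)
    (p : ℕ × ℕ) : (∃ a, moveEntry f h q b p = some a) ↔ p ∈ lam ∧ p ∉ mu ∧ p ≠ q := by
  have hqm := H.mem_of_eq_some hq
  simp only [moveEntry_eq_some_iff hqm.2.2]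
  constructor
  · rintro ⟨a, ⟨rfl, -⟩ | ⟨h1, h2, h3⟩⟩
    · exact ⟨H.mem, H.notMem, hqm.2.2.symm⟩
    · have := H.mem_of_eq_some h3
      exact ⟨this.1, this.2.1, h2⟩
  · rintro ⟨h1, h2, h3⟩
    by_cases hp : p = h
    · exact ⟨b, Or.inl ⟨hp, rfl⟩⟩
    · obtain ⟨a, ha⟩ := H.filled h1 h2 hp
      exact ⟨a, Or.inr ⟨hp, h3, ha⟩⟩

/-- To the right, `b` is bounded by the choice `hr`; an entry to the left is less than the one below
it, which precedes `b` in its old row. -/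
theorem up {i j b : ℕ} (H : Punctured lam mu f (i, j)) (hb : f (i + 1, j) = some b)
    (hr : ∀ r, f (i, j + 1) = some r → b ≤ r) :
    Punctured lam mu (moveEntry f (i, j) (i + 1, j) b) (i + 1, j) := by
  have hq := H.mem_of_eq_some hb
  refine ⟨hq.1, hq.2.1, H.dom_moveEntry hb, ?_, ?_⟩
  · intro x j₁ j₂ a c hj ha hc
    rw [moveEntry_eq_some_iff hq.2.2] at ha hc
    simp only [Prod.mk.injEq, ne_eq] at ha hc
    rcases ha with ⟨⟨rfl, rfl⟩, rfl⟩ | ⟨-, -, ha⟩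
    · rcases hc with ⟨⟨-, rfl⟩, rfl⟩ | ⟨-, -, hc⟩
      · exact le_rfl
      · have hm := H.mem_of_eq_some hc
        obtain ⟨r, hr'⟩ := H.filled (p := (x, j₁ + 1)) (lam.up_left_mem le_rfl hj hm.1)
          (fun h => H.notMem (mu.up_left_mem le_rfl (Nat.le_succ _) h)) (by simp)
        rcases Nat.lt_or_ge (j₁ + 1) j₂ with h | h
        · exact (hr r hr').trans (H.row h hr' hc)
        · obtain rfl : j₂ = j₁ + 1 := by omega
          exact hr c hc
    · rcases hc with ⟨⟨rfl, rfl⟩, rfl⟩ | ⟨-, -, hc⟩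
      · have hm := H.mem_of_eq_some ha
        obtain ⟨r, hr'⟩ := H.filled (p := (x + 1, j₁)) (lam.up_left_mem le_rfl hj.le hq.1)
          (fun h => hm.2.1 (mu.up_left_mem (Nat.le_succ _) le_rfl h)) (by simp)
        exact (H.col (Nat.lt_succ_self x) ha hr').le.trans (H.row hj hr' hb)
      · exact H.row hj ha hc
  · intro i₁ i₂ y a c hi ha hc
    rw [moveEntry_eq_some_iff hq.2.2] at ha hc
    simp only [Prod.mk.injEq, ne_eq] at ha hc
    rcases ha with ⟨⟨rfl, rfl⟩, rfl⟩ | ⟨-, -, ha⟩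
    · rcases hc with ⟨⟨rfl, -⟩, rfl⟩ | ⟨-, h2, hc⟩
      · omega
      · have : i₂ ≠ i₁ + 1 := fun h => h2 ⟨h, rfl⟩
        exact H.col (show i₁ + 1 < i₂ by omega) hb hc
    · rcases hc with ⟨⟨rfl, rfl⟩, rfl⟩ | ⟨-, -, hc⟩
      · exact H.col (show i₁ < i₂ + 1 by omega) ha hb
      · exact H.col hi ha hc

/-- The transposed argument; column strictness needs `r < b`, which is why ties move upwards. -/
theorem left {i j r : ℕ} (H : Punctured lam mu f (i, j)) (hr : f (i, j + 1) = some r)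
    (hb : ∀ b, f (i + 1, j) = some b → r < b) :
    Punctured lam mu (moveEntry f (i, j) (i, j + 1) r) (i, j + 1) := by
  have hq := H.mem_of_eq_some hr
  refine ⟨hq.1, hq.2.1, H.dom_moveEntry hr, ?_, ?_⟩
  · intro x j₁ j₂ a c hj ha hc
    rw [moveEntry_eq_some_iff hq.2.2] at ha hc
    simp only [Prod.mk.injEq, ne_eq] at ha hc
    rcases ha with ⟨⟨rfl, rfl⟩, rfl⟩ | ⟨-, -, ha⟩
    · rcases hc with ⟨⟨-, rfl⟩, rfl⟩ | ⟨-, h2, hc⟩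
      · exact le_rfl
      · have : j₂ ≠ j₁ + 1 := fun h => h2 ⟨rfl, h⟩
        exact H.row (show j₁ + 1 < j₂ by omega) hr hc
    · rcases hc with ⟨⟨rfl, rfl⟩, rfl⟩ | ⟨-, -, hc⟩
      · exact H.row (show j₁ < j₂ + 1 by omega) ha hr
      · exact H.row hj ha hc
  · intro i₁ i₂ y a c hi ha hc
    rw [moveEntry_eq_some_iff hq.2.2] at ha hc
    simp only [Prod.mk.injEq, ne_eq] at ha hc
    rcases ha with ⟨⟨rfl, rfl⟩, rfl⟩ | ⟨-, -, ha⟩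
    · rcases hc with ⟨⟨rfl, -⟩, rfl⟩ | ⟨-, -, hc⟩
      · omega
      · have hm := H.mem_of_eq_some hc
        obtain ⟨b, hb'⟩ := H.filled (p := (i₁ + 1, y)) (lam.up_left_mem hi le_rfl hm.1)
          (fun h => H.notMem (mu.up_left_mem (Nat.le_succ _) le_rfl h)) (by simp)
        rcases Nat.lt_or_ge (i₁ + 1) i₂ with h | h
        · exact (hb b hb').trans (H.col h hb' hc)
        · obtain rfl : i₂ = i₁ + 1 := by omega
          exact hb c hc
    · rcases hc with ⟨⟨rfl, rfl⟩, rfl⟩ | ⟨-, -, hc⟩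
      · have hm := H.mem_of_eq_some ha
        obtain ⟨b, hb'⟩ := H.filled (p := (i₁, y + 1)) (lam.up_left_mem hi.le le_rfl hq.1)
          (fun h => hm.2.1 (mu.up_left_mem le_rfl (Nat.le_succ _) h)) (by simp)
        exact (H.row (Nat.lt_succ_self y) ha hb').trans_lt (H.col hi hb' hr)
      · exact H.col hi ha hc

/-! ### Effect of a move on the contents of columns -/

theorem one_le_columnCount {h : ℕ × ℕ} (H : Punctured lam mu f h) {i j k : ℕ}
    (hk : f (i, j) = some k) : 1 ≤ columnCount lam.cells f j k := by
  refine Finset.card_pos.2 ⟨(i, j), Finset.mem_filter.2 ⟨?_, rfl, hk⟩⟩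
  exact (H.mem_of_eq_some hk).1

theorem columnCount_eq_zero {j k : ℕ} (hk : ∀ i, f (i, j) ≠ some k) :
    columnCount lam.cells f j k = 0 := by
  rw [columnCount, Finset.card_eq_zero, Finset.filter_eq_empty_iff]
  rintro ⟨i, j'⟩ - ⟨rfl, h⟩
  exact hk i h

theorem columnCount_le_one {h : ℕ × ℕ} (H : Punctured lam mu f h) (j k : ℕ) :
    columnCount lam.cells f j k ≤ 1 := by
  rw [columnCount, Finset.card_le_one]
  rintro ⟨i, j'⟩ hx ⟨i', j''⟩ hy
  simp only [Finset.mem_filter] at hx hy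
  obtain ⟨-, rfl, hx⟩ := hx
  obtain ⟨-, rfl, hy⟩ := hy
  rcases lt_trichotomy i i' with hl | rfl | hl
  · exact absurd (H.col hl hx hy) (lt_irrefl _)
  · rfl
  · exact absurd (H.col hl hy hx) (lt_irrefl _)

/-- The lattice condition for the columns of a filling, read from right to left. -/
def ColLattice (B : Finset (ℕ × ℕ)) (f : ℕ × ℕ → Option ℕ) : Prop :=
  ∀ j k, fillCount B f j (k + 1) ≤ fillCount B f j k

theorem fillCount_up {i j b : ℕ} (H : Punctured lam mu f (i, j)) (hb : f (i + 1, j) = some b)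
    (j' k : ℕ) :
    fillCount lam.cells (moveEntry f (i, j) (i + 1, j) b) j' k = fillCount lam.cells f j' k := by
  have hq := H.mem_of_eq_some hb
  have := fillCount_moveEntry (B := lam.cells) H.mem hq.1 hq.2.2 H.hole_eq_none hb j' k
  simpa using this

theorem fillCount_left {i j r : ℕ} (H : Punctured lam mu f (i, j)) (hr : f (i, j + 1) = some r)
    (j' k : ℕ) :
    fillCount lam.cells (moveEntry f (i, j) (i, j + 1) r) j' k +
      (if r = k ∧ j' = j + 1 then 1 else 0) = fillCount lam.cells f j' k := by
  have hq := H.mem_of_eq_some hr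
  have := fillCount_moveEntry (B := lam.cells) H.mem hq.1 hq.2.2 H.hole_eq_none hr j' k
  dsimp only at this
  by_cases h : r = k
  · simp only [h, true_and] at this ⊢
    split_ifs at this ⊢ <;> omega
  · simpa [h] using this

/-- The move lowers just one count, that of `r` in columns from `j + 1` on. The one inequality
endangered in each direction is recovered from the condition at a neighbouring column. -/
theorem colLattice_left {i j r : ℕ} (H : Punctured lam mu f (i, j)) (hr : f (i, j + 1) = some r)
    (hb : ∀ b, f (i + 1, j) = some b → r < b) :
    ColLattice lam.cells f ↔ ColLattice lam.cells (moveEntry f (i, j) (i, j + 1) r) := by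
  have hq := H.mem_of_eq_some hr
  have H' := H.left hr hb
  have hcount := H.fillCount_left hr
  constructor
  · intro hf j' k
    have h1 := hcount j' k
    have h2 := hcount j' (k + 1)
    have h3 := hf j' k
    by_cases hc : r = k ∧ j' = j + 1
    swap
    · rw [if_neg hc] at h1
      omega
    obtain ⟨rfl, rfl⟩ := hc
    rw [if_pos ⟨rfl, rfl⟩] at h1
    rw [if_neg (by omega)] at h2
    -- A strict inequality at column `j + 1` is needed. If that column contains `r + 1`, column `j`
    -- turns out to contain `r + 1` but not `r`, and the condition at `j` is strict enough;
    -- otherwise the `r` in column `j + 1` adds one to the condition at `j + 2`.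
    by_cases hex : ∃ i', f (i', j + 1) = some (r + 1)
    · obtain ⟨i', hi'⟩ := hex
      have hm := H.mem_of_eq_some hi'
      have hii : i < i' := by
        rcases lt_trichotomy i i' with h | rfl | h
        · exact h
        · rw [hr] at hi'; simp at hi'
        · have := H.col h hi' hr; omega
      obtain ⟨b, hb'⟩ := H.filled (p := (i', j)) (lam.up_left_mem le_rfl (Nat.le_succ _) hm.1)
        (fun h => H.notMem (mu.up_left_mem hii.le le_rfl h)) (by simp; omega)
      have e1 := H.row (Nat.lt_succ_self j) hb' hi'
      obtain ⟨b0, hb0⟩ := H.filled (p := (i + 1, j))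
        (lam.up_left_mem hii le_rfl (H.mem_of_eq_some hb').1)
        (fun h => H.notMem (mu.up_left_mem (Nat.le_succ _) le_rfl h)) (by simp)
      have e2 := hb b0 hb0
      have e3 : b0 ≤ b := by
        rcases Nat.lt_or_ge (i + 1) i' with h | h
        · exact (H.col h hb0 hb').le
        · obtain rfl : i' = i + 1 := by omega
          rw [hb0] at hb'
          exact (Option.some.inj hb').le
      obtain rfl : b = r + 1 := by omega
      have c1 := H.one_le_columnCount hb'
      have c2 : columnCount lam.cells f j r = 0 := by
        refine columnCount_eq_zero fun x hx => ?_
        have hxm := H.mem_of_eq_some hx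
        rcases lt_trichotomy x i with h | rfl | h
        · obtain ⟨y, hy⟩ := H.filled (p := (x, j + 1)) (lam.up_left_mem h.le le_rfl hq.1)
            (fun h => hxm.2.1 (mu.up_left_mem le_rfl (Nat.le_succ _) h)) (by simp)
          have e4 := H.row (Nat.lt_succ_self j) hx hy
          have e5 := H.col h hy hr
          omega
        · exact hxm.2.2 rfl
        · rcases Nat.lt_or_ge (i + 1) x with h' | h'
          · have := H.col h' hb0 hx; omega
          · obtain rfl : x = i + 1 := by omega
            have := hb r hx
            omega
      have d1 := fillCount_eq_add lam.cells f j r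
      have d2 := fillCount_eq_add lam.cells f j (r + 1)
      have d3 := hf j r
      omega
    · have c1 : columnCount lam.cells f (j + 1) (r + 1) = 0 :=
        columnCount_eq_zero fun x hx => hex ⟨x, hx⟩
      have c2 := H.one_le_columnCount hr
      have d1 := fillCount_eq_add lam.cells f (j + 1) r
      have d2 := fillCount_eq_add lam.cells f (j + 1) (r + 1)
      have d3 := hf (j + 1 + 1) r
      omega
  · intro hf j' k
    have h1 := hcount j' k
    have h2 := hcount j' (k + 1)
    have h3 := hf j' k
    by_cases hc : r = k + 1 ∧ j' = j + 1
    swap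
    · rw [if_neg hc] at h2
      omega
    obtain ⟨rfl, rfl⟩ := hc
    rw [if_pos ⟨rfl, rfl⟩] at h2
    rw [if_neg (by omega)] at h1
    have hmove := moveEntry_eq_some_iff (f := f) (b := k + 1) hq.2.2
    -- If column `j + 1` contains `k`, the condition at `j + 2` suffices; otherwise, after the move,
    -- column `j` contains `k + 1` but not `k`, and the condition there gives the missing one.
    by_cases hex : ∃ i', f (i', j + 1) = some k
    · obtain ⟨i', hi'⟩ := hex
      have c1 := H.one_le_columnCount hi'
      have c2 := H.columnCount_le_one (j + 1) (k + 1)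
      have d1 := fillCount_eq_add lam.cells f (j + 1) k
      have d2 := fillCount_eq_add lam.cells f (j + 1) (k + 1)
      have d3 := hf (j + 1 + 1) k
      have g1 := hcount (j + 1 + 1) k
      have g2 := hcount (j + 1 + 1) (k + 1)
      rw [if_neg (by omega)] at g1 g2
      omega
    · have c1 : 1 ≤ columnCount lam.cells (moveEntry f (i, j) (i, j + 1) (k + 1)) j (k + 1) :=
        H'.one_le_columnCount ((hmove (i, j) (k + 1)).2 (Or.inl ⟨rfl, rfl⟩))
      have c2 : columnCount lam.cells (moveEntry f (i, j) (i, j + 1) (k + 1)) j k = 0 := by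
        refine columnCount_eq_zero fun x hx => ?_
        have hx' := (hmove (x, j) k).1 hx
        have hf0 : f (x, j) = some k := by
          rcases hx' with ⟨-, h⟩ | ⟨-, -, h⟩
          · omega
          · exact h
        have hxm := H.mem_of_eq_some hf0
        rcases lt_trichotomy x i with h | rfl | h
        · obtain ⟨y, hy⟩ := H.filled (p := (x, j + 1)) (lam.up_left_mem h.le le_rfl hq.1)
            (fun h => hxm.2.1 (mu.up_left_mem le_rfl (Nat.le_succ _) h)) (by simp)
          have e4 := H.row (Nat.lt_succ_self j) hf0 hy
          have e5 := H.col h hy hr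
          obtain rfl : y = k := by omega
          exact hex ⟨x, hy⟩
        · exact hxm.2.2 rfl
        · have e1 := H'.col h ((hmove (i, j) (k + 1)).2 (Or.inl ⟨rfl, rfl⟩)) hx
          omega
      have d1 := fillCount_eq_add lam.cells (moveEntry f (i, j) (i, j + 1) (k + 1)) j k
      have d2 := fillCount_eq_add lam.cells (moveEntry f (i, j) (i, j + 1) (k + 1)) j (k + 1)
      have d3 := hf j k
      omega

theorem step {A B : (ℕ × ℕ → Option ℕ) × (ℕ × ℕ)} (H : Punctured lam mu A.1 A.2)
    (hs : SlideStep A B) : Punctured lam mu B.1 B.2 ∧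
      (ColLattice lam.cells A.1 ↔ ColLattice lam.cells B.1) ∧
      ∀ k, fillCount lam.cells A.1 0 k = fillCount lam.cells B.1 0 k := by
  cases hs with
  | up f i j b hb hr =>
    refine ⟨H.up hb hr, ?_, fun k => (H.fillCount_up hb 0 k).symm⟩
    have h := H.fillCount_up hb
    rw [moveEntry] at h
    simp only [ColLattice, h]
  | left f i j r hr hb =>
    refine ⟨H.left hr hb, H.colLattice_left hr hb, fun k => ?_⟩
    have := H.fillCount_left hr 0 k
    rw [if_neg (by omega)] at this
    exact this.symm

theorem steps {A B : (ℕ × ℕ → Option ℕ) × (ℕ × ℕ)} (H : Punctured lam mu A.1 A.2)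
    (hs : Relation.ReflTransGen SlideStep A B) : Punctured lam mu B.1 B.2 ∧
      (ColLattice lam.cells A.1 ↔ ColLattice lam.cells B.1) ∧
      ∀ k, fillCount lam.cells A.1 0 k = fillCount lam.cells B.1 0 k := by
  induction hs with
  | refl => exact ⟨H, Iff.rfl, fun _ => rfl⟩
  | tail _ h ih =>
    obtain ⟨h1, h2, h3⟩ := ih.1.step h
    exact ⟨h1, ih.2.1.trans h2, fun k => (ih.2.2 k).trans (h3 k)⟩

/-- The moves of a slide end. -/
theorem exists_terminal {h : ℕ × ℕ} (H : Punctured lam mu f h) : ∃ f' h',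
    Relation.ReflTransGen SlideStep (f, h) (f', h') ∧ Punctured lam mu f' h' ∧
      f' (h'.1 + 1, h'.2) = none ∧ f' (h'.1, h'.2 + 1) = none := by
  -- Each move raises the coordinate sum of the hole, which is bounded on the outer shape.
  induction hN : lam.cells.sup (fun p => p.1 + p.2) - (h.1 + h.2) using
    Nat.strong_induction_on generalizing f h with
  | _ N ih =>
    have hstep : ∀ f' h', SlideStep (f, h) (f', h') → h.1 + h.2 < h'.1 + h'.2 →
        ∃ f' h', Relation.ReflTransGen SlideStep (f, h) (f', h') ∧ Punctured lam mu f' h' ∧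
          f' (h'.1 + 1, h'.2) = none ∧ f' (h'.1, h'.2 + 1) = none := by
      intro f' h' hs hlt
      have H' : Punctured lam mu f' h' := (H.step hs).1
      have hle : h'.1 + h'.2 ≤ lam.cells.sup (fun p => p.1 + p.2) :=
        Finset.le_sup (f := fun p : ℕ × ℕ => p.1 + p.2) H'.mem
      obtain ⟨f'', h'', h1, h2⟩ := ih _ (by omega) H' rfl
      exact ⟨f'', h'', h1.head hs, h2⟩
    obtain ⟨i, j⟩ := h
    rcases hd : f (i + 1, j) with _ | b
    · rcases hr : f (i, j + 1) with _ | r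
      · exact ⟨f, (i, j), .refl, H, hd, hr⟩
      · exact hstep _ _ (.left f i j r hr (by simp [hd])) (by dsimp only; omega)
    · by_cases hbr : ∀ r, f (i, j + 1) = some r → b ≤ r
      · exact hstep _ _ (.up f i j b hd hbr) (by dsimp only; omega)
      · push Not at hbr
        obtain ⟨r, hr, hlt⟩ := hbr
        refine hstep _ _ (.left f i j r hr fun b' hb' => ?_) (by dsimp only; omega)
        rw [hd] at hb'
        exact Option.some.inj hb' ▸ hlt

end Punctured

/-! ### Slides -/

/-- The Young diagram obtained by removing a corner. -/
def eraseCorner (ν : YoungDiagram) (s : ℕ × ℕ) (h1 : (s.1 + 1, s.2) ∉ ν)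
    (h2 : (s.1, s.2 + 1) ∉ ν) : YoungDiagram where
  cells := ν.cells.erase s
  isLowerSet := by
    intro p q hqp hp
    simp only [Finset.coe_erase, Set.mem_sdiff, Finset.mem_coe, YoungDiagram.mem_cells,
      Set.mem_singleton_iff] at hp ⊢
    refine ⟨ν.isLowerSet hqp hp.1, ?_⟩
    rintro rfl
    obtain ⟨p1, p2⟩ := p
    obtain ⟨q1, q2⟩ := q
    have h3 : q1 ≤ p1 ∧ q2 ≤ p2 := hqp
    have h4 : q1 < p1 ∨ q2 < p2 := by
      by_contra hc
      exact hp.2 (Prod.ext (by dsimp only; omega) (by dsimp only; omega))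
    rcases h4 with h4 | h4
    · exact h1 (ν.up_left_mem h4 h3.2 hp.1)
    · exact h2 (ν.up_left_mem h3.1 h4 hp.1)

theorem exists_corner {ν : YoungDiagram} (h : ν.cells.Nonempty) :
    ∃ s ∈ ν.cells, (s.1 + 1, s.2) ∉ ν ∧ (s.1, s.2 + 1) ∉ ν := by
  obtain ⟨s, hs, hmax⟩ := ν.cells.exists_max_image (fun p => p.1 + p.2) h
  refine ⟨s, hs, fun hc => ?_, fun hc => ?_⟩
  · have := hmax _ hc; dsimp only at this; omega
  · have := hmax _ hc; dsimp only at this; omega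

namespace Tab

variable {χ χ' : SkewShape}

theorem filling_eq_some_iff (T : Tab χ) (p : ℕ × ℕ) (k : ℕ) :
    T.filling p = some k ↔ p ∈ χ.cells ∧ T.entry p.1 p.2 = k := by
  rw [filling]
  split_ifs with h <;> simp [h]

theorem fillCount_filling (T : Tab χ) {B : Finset (ℕ × ℕ)} (hB : χ.cells ⊆ B) (j k : ℕ) :
    fillCount B T.filling j k = T.colCount j k := by
  rw [fillCount, colCount]
  congr 1
  ext p
  simp only [Finset.mem_filter, filling_eq_some_iff]
  constructor
  · rintro ⟨-, h1, h2, h3⟩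
    exact ⟨h2, h1, h3⟩
  · rintro ⟨h1, h2, h3⟩
    exact ⟨hB h1, h2, h1, h3⟩

theorem isLR_iff_colLattice (T : Tab χ) {B : Finset (ℕ × ℕ)} (hB : χ.cells ⊆ B) :
    T.IsLR ↔ Punctured.ColLattice B T.filling := by
  simp only [T.isLR_iff_colCount, Punctured.ColLattice, T.fillCount_filling hB]

theorem colCount_zero (T : Tab χ) (k : ℕ) : T.colCount 0 k = T.wt k := by
  simp [colCount, wt_apply]

theorem punctured (T : Tab χ) {mu : YoungDiagram} {s : ℕ × ℕ} (hs : s ∈ χ.inner.cells)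
    (hmu : mu.cells = χ.inner.cells.erase s) : Punctured χ.outer mu T.filling s := by
  have hmu' : ∀ p, p ∈ mu ↔ p ≠ s ∧ p ∈ χ.inner := fun p => by
    rw [← YoungDiagram.mem_cells, hmu, Finset.mem_erase, YoungDiagram.mem_cells]
  refine ⟨χ.le hs, by simp [hmu'], fun p => ?_, ?_, ?_⟩
  · simp only [filling_eq_some_iff, exists_and_left, exists_eq', and_true, SkewShape.cells,
      Finset.mem_sdiff, YoungDiagram.mem_cells, hmu', not_and]
    constructor
    · rintro ⟨h1, h2⟩
      exact ⟨h1, fun _ => h2, fun h => h2 (h ▸ hs)⟩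
    · rintro ⟨h1, h2, h3⟩
      exact ⟨h1, h2 h3⟩
  · intro i j₁ j₂ a b hj ha hb
    rw [filling_eq_some_iff] at ha hb
    rw [← ha.2, ← hb.2]
    exact T.row_weak hj ha.1 hb.1
  · intro i₁ i₂ j a b hi ha hb
    rw [filling_eq_some_iff] at ha hb
    rw [← ha.2, ← hb.2]
    exact T.col_strict hi ha.1 hb.1

end Tab

theorem InwardSlide.invariants {χ χ' : SkewShape} {T : Tab χ} {T' : Tab χ'}
    (h : InwardSlide T T') : (T.IsLR ↔ T'.IsLR) ∧ ∀ k, T.wt k = T'.wt k := by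
  obtain ⟨s, t, hs, hmu, ht, hlam, hsteps, -, -⟩ := h
  obtain ⟨-, h2, h3⟩ := (T.punctured hs hmu).steps hsteps
  -- The old outer shape contains the squares of both tableaux, so both are counted inside it.
  have c1 : χ.cells ⊆ χ.outer.cells := Finset.sdiff_subset
  have c2 : χ'.cells ⊆ χ.outer.cells :=
    Finset.sdiff_subset.trans (hlam ▸ Finset.erase_subset _ _)
  refine ⟨?_, fun k => ?_⟩
  · rw [T.isLR_iff_colLattice c1, T'.isLR_iff_colLattice c2]
    exact h2
  · have := h3 k
    rwa [T.fillCount_filling c1, T'.fillCount_filling c2, T.colCount_zero, T'.colCount_zero] at this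

theorem SlidesTo.invariants {χ χ' : SkewShape} {T : Tab χ} {T' : Tab χ'}
    (h : SlidesTo T T') : (T.IsLR ↔ T'.IsLR) ∧ ∀ k, T.wt k = T'.wt k := by
  have key : ∀ B : (Σ ψ : SkewShape, Tab ψ),
      Relation.ReflTransGen (fun A B : (Σ ψ : SkewShape, Tab ψ) => InwardSlide A.2 B.2) ⟨χ, T⟩ B →
      (T.IsLR ↔ B.2.IsLR) ∧ ∀ k, T.wt k = B.2.wt k := by
    intro B hB
    induction hB with
    | refl => exact ⟨Iff.rfl, fun _ => rfl⟩
    | tail _ h ih =>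
      have := h.invariants
      exact ⟨ih.1.trans this.1, fun k => (ih.2 k).trans (this.2 k)⟩
  exact key _ h

theorem exists_inwardSlide {χ : SkewShape} (T : Tab χ) (h : χ.inner.cells.Nonempty) :
    ∃ (χ' : SkewShape) (T' : Tab χ'), InwardSlide T T' ∧
      χ'.inner.cells.card < χ.inner.cells.card := by
  obtain ⟨s, hs, hs1, hs2⟩ := exists_corner h
  let mu := eraseCorner χ.inner s hs1 hs2
  have hmu : mu.cells = χ.inner.cells.erase s := rfl
  obtain ⟨f, t, hsteps, H, hd, hr⟩ := (T.punctured hs hmu).exists_terminal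
  -- Squares beyond `t` avoid the lower set `mu`, so an empty one must be outside the outer shape.
  -- Hence `t` is a corner that may be removed.
  have hnot : ∀ q, q ≠ t → t ≤ q → f q = none → q ∉ χ.outer := by
    intro q hqt hle hq hmem
    obtain ⟨a, ha⟩ := H.filled hmem (fun hc => H.notMem (mu.isLowerSet hle hc)) hqt
    rw [hq] at ha
    cases ha
  have ht1 : (t.1 + 1, t.2) ∉ χ.outer :=
    hnot _ (fun h => by have := congrArg Prod.fst h; simp at this) ⟨by simp, by simp⟩ hd
  have ht2 : (t.1, t.2 + 1) ∉ χ.outer :=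
    hnot _ (fun h => by have := congrArg Prod.snd h; simp at this) ⟨by simp, by simp⟩ hr
  let lam := eraseCorner χ.outer t ht1 ht2
  have hlam : lam.cells = χ.outer.cells.erase t := rfl
  have hle : mu ≤ lam := by
    intro p hp
    have hp' : p ∈ mu.cells := hp
    rw [hmu, Finset.mem_erase] at hp'
    change p ∈ lam.cells
    rw [hlam, Finset.mem_erase]
    exact ⟨fun h => H.notMem (h ▸ hp), χ.le hp'.2⟩
  have hcells : ∀ p, p ∈ (SkewShape.mk lam mu hle).cells ↔ ∃ a, f p = some a := by
    intro p
    rw [H.dom p, SkewShape.cells, Finset.mem_sdiff]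
    dsimp only
    rw [hlam, Finset.mem_erase, YoungDiagram.mem_cells, YoungDiagram.mem_cells]
    tauto
  have hget : ∀ p, p ∈ (SkewShape.mk lam mu hle).cells → f p = some ((f p).getD 0) := by
    intro p hp
    obtain ⟨a, ha⟩ := (hcells p).1 hp
    rw [ha, Option.getD_some]
  let T' : Tab ⟨lam, mu, hle⟩ :=
    { entry := fun i j => (f (i, j)).getD 0
      row_weak := fun hj h1 h2 => H.row hj (hget _ h1) (hget _ h2)
      col_strict := fun hi h1 h2 => H.col hi (hget _ h1) (hget _ h2)
      zeros := by
        intro i j hij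
        rcases hf : f (i, j) with _ | a
        · rfl
        · exact absurd ((hcells _).2 ⟨a, hf⟩) hij }
  have hT' : T'.filling = f := by
    funext p
    rw [Tab.filling]
    split_ifs with hp
    · exact (hget p hp).symm
    · rcases hf : f p with _ | a
      · rfl
      · exact absurd ((hcells _).2 ⟨a, hf⟩) hp
  refine ⟨⟨lam, mu, hle⟩, T', ⟨s, t, hs, hmu, H.mem, hlam, ?_, ?_, ?_⟩, ?_⟩
  · rwa [hT']
  · rwa [hT']
  · rwa [hT']
  · exact Finset.card_erase_lt_of_mem hs

theorem exists_rectification {χ : SkewShape} (L : Tab χ) :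
    ∃ (ν : YoungDiagram) (P : Tab (SkewShape.ofPartition ν)), SlidesTo L P := by
  induction hN : χ.inner.cells.card using Nat.strong_induction_on generalizing χ with
  | _ N ih =>
    by_cases hne : χ.inner.cells.Nonempty
    · obtain ⟨χ', T', hs, hlt⟩ := exists_inwardSlide L hne
      obtain ⟨ν, P, hP⟩ := ih _ (hN ▸ hlt) T' rfl
      exact ⟨ν, P, Relation.ReflTransGen.head hs hP⟩
    · obtain ⟨lam, mu, hle⟩ := χ
      obtain rfl : mu = ⊥ := by
        ext p
        simp only [Finset.not_nonempty_iff_eq_empty] at hne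
        simp [hne]
      exact ⟨lam, L, Relation.ReflTransGen.refl⟩

/-! ### Littlewood-Richardson tableaux of partition shape -/

/-- An entry `k + 1` must be preceded in the reading by a `k`; weakly increasing rows force that `k`
into an earlier row, where induction applies. -/
theorem Tab.IsLR.entry_le {χ : SkewShape} {T : Tab χ} (hT : T.IsLR) {r c : ℕ}
    (h : (r, c) ∈ χ.cells) : T.entry r c ≤ r := by
  induction r using Nat.strong_induction_on generalizing c with
  | _ r ih =>
    by_contra hc
    obtain ⟨k, hk⟩ : ∃ k, T.entry r c = k + 1 := ⟨T.entry r c - 1, by omega⟩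
    have h1 := hT r c k
    have h2 : 0 < T.prefixCount r c (k + 1) :=
      Finset.card_pos.2 ⟨(r, c), Finset.mem_filter.2 ⟨h, Or.inr ⟨rfl, le_rfl⟩, hk⟩⟩
    obtain ⟨⟨i, j⟩, hp⟩ := Finset.card_pos.1 (h2.trans_le h1)
    obtain ⟨hm, h3, h4⟩ := Finset.mem_filter.1 hp
    dsimp only at h3 h4
    rcases h3 with h3 | ⟨rfl, h3⟩
    · have := ih i h3 hm
      omega
    · rcases h3.lt_or_eq with h5 | rfl
      · have := T.row_weak h5 h hm
        omega
      · omega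

theorem mem_ofPartition_cells {ν : YoungDiagram} {p : ℕ × ℕ} :
    p ∈ (SkewShape.ofPartition ν).cells ↔ p ∈ ν := by
  simp [SkewShape.cells, SkewShape.ofPartition]

theorem le_entry_of_partition {ν : YoungDiagram} (P : Tab (SkewShape.ofPartition ν)) {i j : ℕ}
    (h : (i, j) ∈ ν) : i ≤ P.entry i j := by
  induction i with
  | zero => exact Nat.zero_le _
  | succ i ih =>
    have h' : (i, j) ∈ ν := ν.up_left_mem (Nat.le_succ i) le_rfl h
    have h1 := P.col_strict (Nat.lt_succ_self i) (mem_ofPartition_cells.2 h')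
      (mem_ofPartition_cells.2 h)
    have h2 := ih h'
    simp only [Nat.succ_eq_add_one] at h1
    omega

theorem canonical_entry {ν : YoungDiagram} {i j : ℕ} (h : (i, j) ∈ ν) :
    (canonical ν).entry i j = i :=
  if_pos (mem_ofPartition_cells.2 h)

theorem isLR_canonical (ν : YoungDiagram) : (canonical ν).IsLR := by
  rw [Tab.isLR_iff_colCount]
  intro j k
  -- Each `k + 1` is sent to the `k` directly above it; it lies in row `k + 1`, so nothing is
  -- truncated.
  refine Finset.card_le_card_of_injOn (fun p => (p.1 - 1, p.2)) ?_ ?_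
  · rintro ⟨x, y⟩ h
    simp only [Finset.coe_filter, Set.mem_ofPred_eq, mem_ofPartition_cells] at h ⊢
    obtain ⟨h1, h2, h3⟩ := h
    rw [canonical_entry h1] at h3
    have h4 : (x - 1, y) ∈ ν := ν.up_left_mem (Nat.sub_le x 1) le_rfl h1
    refine ⟨h4, h2, ?_⟩
    rw [canonical_entry h4]
    omega
  · rintro ⟨x, y⟩ h ⟨x', y'⟩ h' he
    simp only [Finset.coe_filter, Set.mem_ofPred_eq, mem_ofPartition_cells] at h h'
    obtain ⟨h1, h2, h3⟩ := h
    obtain ⟨h1', h2', h3'⟩ := h'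
    rw [canonical_entry h1] at h3
    rw [canonical_entry h1'] at h3'
    simp only [Prod.mk.injEq] at he ⊢
    omega

theorem isLR_iff_eq_canonical {ν : YoungDiagram} (P : Tab (SkewShape.ofPartition ν)) :
    P.IsLR ↔ P = canonical ν := by
  refine ⟨fun h => ?_, fun h => h ▸ isLR_canonical ν⟩
  ext i j
  by_cases hm : (i, j) ∈ ν
  · rw [canonical_entry hm]
    exact le_antisymm (h.entry_le (mem_ofPartition_cells.2 hm)) (le_entry_of_partition P hm)
  · have : (i, j) ∉ (SkewShape.ofPartition ν).cells := fun h => hm (mem_ofPartition_cells.1 h)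
    rw [P.zeros this, (canonical ν).zeros this]

theorem wt_canonical (ν : YoungDiagram) (k : ℕ) : (canonical ν).wt k = ν.rowLen k := by
  rw [Tab.wt_apply, YoungDiagram.rowLen_eq_card, YoungDiagram.row]
  congr 1
  ext ⟨i, j⟩
  simp only [Finset.mem_filter, mem_ofPartition_cells, YoungDiagram.mem_cells]
  refine and_congr_right fun h => ?_
  rw [canonical_entry h]

theorem setOf_slidesTo_canonical (χ : SkewShape) (ν : YoungDiagram) :
    {L : Tab χ | SlidesTo L (canonical ν)} = LR χ ν := by
  ext L
  constructor
  · intro h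
    have hi := SlidesTo.invariants h
    exact ⟨hi.1.2 (isLR_canonical ν), fun k => (hi.2 k).trans (wt_canonical ν k)⟩
  · rintro ⟨h1, h2⟩
    obtain ⟨ν', P, hP⟩ := exists_rectification L
    have hi := hP.invariants
    obtain rfl := (isLR_iff_eq_canonical P).1 (hi.1.1 h1)
    -- The weight is invariant under slides and determines the shape of the canonical tableau.
    obtain rfl : ν' = ν := eq_of_rowLen fun k => by
      rw [← wt_canonical, ← hi.2, h2]
    exact hP


/-! ### Finiteness -/

theorem Tab.card_cells {χ : SkewShape} (T : Tab χ) : χ.cells.card = T.wt.degree := by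
  rw [Tab.wt, map_sum]
  simp

theorem card_cells_of_mem_LR {χ : SkewShape} {ν : YoungDiagram} {T : Tab χ} (h : T ∈ LR χ ν) :
    χ.cells.card = ν.cells.card := by
  have h1 : T.wt = (canonical ν).wt := by
    ext k
    rw [h.2 k, wt_canonical]
  have h2 : (SkewShape.ofPartition ν).cells = ν.cells := by
    ext p
    rw [mem_ofPartition_cells, YoungDiagram.mem_cells]
  rw [T.card_cells, h1, ← (canonical ν).card_cells, h2]

/-- Such a diagram fits into an `N` by `N` box, since it contains everything above and to the left
of each of its squares. -/
theorem finite_setOf_card_le (N : ℕ) : {ν : YoungDiagram | ν.cells.card ≤ N}.Finite := by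
  refine Set.Finite.of_finite_image (f := YoungDiagram.cells)
    ((Finset.range N ×ˢ Finset.range N).powerset.finite_toSet.subset ?_)
    fun ν _ ν' _ h => YoungDiagram.ext h
  rintro _ ⟨ν, hν, rfl⟩
  rw [Finset.mem_coe, Finset.mem_powerset]
  rintro ⟨i, j⟩ hij
  have h1 : i + 1 ≤ ν.cells.card := by
    rw [← Finset.card_range (i + 1)]
    refine Finset.card_le_card_of_injOn (fun x => (x, j)) (fun x hx => ?_)
      fun x _ y _ h => (Prod.mk.inj h).1
    exact ν.up_left_mem (Nat.lt_succ_iff.1 (Finset.mem_range.1 hx)) le_rfl hij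
  have h2 : j + 1 ≤ ν.cells.card := by
    rw [← Finset.card_range (j + 1)]
    refine Finset.card_le_card_of_injOn (fun x => (i, x)) (fun x hx => ?_)
      fun x _ y _ h => (Prod.mk.inj h).2
    exact ν.up_left_mem le_rfl (Nat.lt_succ_iff.1 (Finset.mem_range.1 hx)) hij
  have h3 : ν.cells.card ≤ N := hν
  rw [Finset.mem_product, Finset.mem_range, Finset.mem_range]
  exact ⟨by dsimp only; omega, by dsimp only; omega⟩

theorem finite_setOf_LR_nonempty (χ : SkewShape) :
    {ν : YoungDiagram | (LR χ ν).Nonempty}.Finite :=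
  (finite_setOf_card_le χ.cells.card).subset fun _ ⟨_, hT⟩ => (card_cells_of_mem_LR hT).ge

theorem finite_setOf_LR_skew_nonempty (lam mu : YoungDiagram) :
    {ν : YoungDiagram | ∃ h : lam ≤ ν, (LR ⟨ν, lam, h⟩ mu).Nonempty}.Finite := by
  refine (finite_setOf_card_le (lam.cells.card + mu.cells.card)).subset ?_
  rintro ν ⟨h, T, hT⟩
  have h1 := card_cells_of_mem_LR hT
  have h2 := Finset.le_card_sdiff lam.cells ν.cells
  rw [SkewShape.cells] at h1
  change ν.cells.card ≤ _
  dsimp only at h1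
  omega

theorem Tab.IsLR.bounded {χ : SkewShape} {T : Tab χ} (hT : T.IsLR) {n : ℕ}
    (hn : χ.outer.colLen 0 ≤ n) : T.Bounded n := by
  intro i c h
  refine (hT.entry_le h).trans_lt ?_
  by_contra hc
  have h1 := χ.mem_cells_iff.1 h
  rw [rowLen_eq_zero (hn.trans (not_lt.1 hc))] at h1
  omega

theorem finite_LR (χ : SkewShape) (ν : YoungDiagram) : (LR χ ν).Finite := by
  have : Finite {T : Tab χ | T.Bounded (χ.outer.colLen 0)} :=
    Finite.of_equiv _ (Tab.chainEquiv χ le_rfl).symm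
  exact (Set.toFinite {T : Tab χ | T.Bounded (χ.outer.colLen 0)}).subset
    fun T hT => hT.1.bounded le_rfl

/-- Littlewood-Richardson tableaux correspond to dominant chains. -/
noncomputable def LREquiv (χ : SkewShape) (ν : YoungDiagram) {n : ℕ}
    (hn : χ.outer.colLen 0 ≤ n) :
    LR χ ν ≃ {g : Chain n χ.inner.rowLen χ.outer.rowLen //
      RowDom 0 g.val ∧ ∀ k, (0 : ℕ → ℕ) k + chainWt n g.val k = ν.rowLen k} :=
  (Equiv.subtypeSubtypeEquivSubtype (p := fun T : Tab χ => T.Bounded n)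
    (q := fun T => T ∈ LR χ ν) fun h => h.1.bounded hn).symm.trans
  ((Tab.chainEquiv χ hn).subtypeEquiv fun T => by
    refine and_congr T.1.isLR_iff_rowDom (forall_congr' fun k => ?_)
    rw [T.1.wt_eq_chainWt hn, Pi.zero_apply, zero_add]
    rfl)

/-! ### Schur functions in finitely many variables -/

/-- Setting the variables from `n` on to zero keeps exactly the tableaux with entries below `n`. -/
theorem killCompl_schur (χ : SkewShape) {n : ℕ} (hn : χ.outer.colLen 0 ≤ n) :
    MvPowerSeries.killCompl Fin.valEmbedding (schur χ) =
      Chain.series n χ.inner.rowLen χ.outer.rowLen := by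
  classical
  ext d
  rw [MvPowerSeries.coeff_killCompl, Chain.series, map_sum]
  simp only [coeff_expMonomial, Finset.sum_boole]
  change ((Nat.card {T : Tab χ // T.wt = Finsupp.embDomain Fin.valEmbedding d} : ℕ) : ℤ) = _
  rw [← Fintype.card_subtype, ← Nat.card_eq_fintype_card]
  have hbd : ∀ {T : Tab χ}, T.wt = Finsupp.embDomain Fin.valEmbedding d → T.Bounded n := by
    intro T hT
    refine T.bounded_of_wt fun k hk => ?_
    rw [hT, Finsupp.embDomain_of_notMem_range]
    rintro ⟨x, rfl⟩
    exact absurd x.2 (not_lt.2 hk)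
  refine congrArg Nat.cast (Nat.card_congr ((Equiv.subtypeSubtypeEquivSubtype hbd).symm.trans
    ((Tab.chainEquiv χ hn).subtypeEquiv fun T => ?_)))
  have key : ∀ x : Fin n, (Tab.chainEquiv χ hn T).wt x = T.1.wt x :=
    fun x => (T.1.wt_eq_chainWt hn x).symm
  constructor
  · intro h
    funext x
    rw [key, h]
    exact (Finsupp.embDomain_apply_self Fin.valEmbedding d x).symm
  · intro h
    ext k
    by_cases hk : k < n
    · have h1 := key ⟨k, hk⟩
      rw [← h] at h1
      exact h1.symm.trans (Finsupp.embDomain_apply_self Fin.valEmbedding d ⟨k, hk⟩).symm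
    · rw [T.2.wt_eq_zero (not_lt.1 hk), Finsupp.embDomain_of_notMem_range]
      rintro ⟨x, rfl⟩
      exact hk x.2

theorem killCompl_schur_partition (ν : YoungDiagram) {n : ℕ} (hn : ν.colLen 0 ≤ n) :
    MvPowerSeries.killCompl Fin.valEmbedding (schur (SkewShape.ofPartition ν)) =
      Chain.series n 0 ν.rowLen := by
  rw [killCompl_schur (SkewShape.ofPartition ν) hn, ← rowLen_bot]
  rfl

/-- Each monomial involves finitely many variables, so it is seen for some large `n`. -/
theorem eq_of_killCompl {F G : MvPowerSeries ℕ ℤ} (N : ℕ)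
    (h : ∀ n, N ≤ n → MvPowerSeries.killCompl (Fin.valEmbedding (n := n)) F =
      MvPowerSeries.killCompl Fin.valEmbedding G) : F = G := by
  ext d
  have hd : d ∈ Set.range
      (Finsupp.embDomain (M := ℕ) (Fin.valEmbedding (n := max N (d.support.sup id + 1)))) := by
    rw [Finsupp.mem_range_embDomain_iff]
    intro k hk
    have h1 : k ≤ d.support.sup id := Finset.le_sup (f := id) hk
    exact ⟨⟨k, lt_max_of_lt_right (Nat.lt_succ_of_le h1)⟩, rfl⟩
  obtain ⟨e, he⟩ := hd
  have h1 := congrArg (MvPowerSeries.coeff e) (h _ (le_max_left N (d.support.sup id + 1)))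
  rwa [MvPowerSeries.coeff_killCompl, MvPowerSeries.coeff_killCompl, he] at h1

/-! ### The Littlewood-Richardson rule -/

theorem exists_rowLen_eq {a : ℕ → ℕ} (ha : Antitone a) {n : ℕ} (hn : ∀ i, n ≤ i → a i = 0) :
    ∃ ν : YoungDiagram, ∀ i, ν.rowLen i = a i := by
  let ν : YoungDiagram :=
    { cells := (Finset.range n ×ˢ Finset.range (a 0)).filter fun p => p.2 < a p.1
      isLowerSet := by
        rintro ⟨p1, p2⟩ ⟨q1, q2⟩ ⟨h1, h2⟩ hp
        simp only [Finset.coe_filter, Finset.mem_product, Finset.mem_range,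
          Set.mem_ofPred_eq] at hp h1 h2 ⊢
        have := ha h1
        omega }
  have hmem : ∀ i j, (i, j) ∈ ν ↔ j < a i := by
    intro i j
    rw [← YoungDiagram.mem_cells]
    simp only [ν, Finset.mem_filter, Finset.mem_product, Finset.mem_range]
    refine ⟨fun h => h.2, fun h => ⟨⟨?_, h.trans_le (ha (Nat.zero_le i))⟩, h⟩⟩
    by_contra hc
    rw [hn i (not_lt.1 hc)] at h
    omega
  refine ⟨ν, fun i => eq_of_forall_lt_iff fun j => ?_⟩
  rw [← YoungDiagram.mem_iff_lt_rowLen, hmem]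

/-- The chains that are dominant relative to `lam` and whose weight leads from `lam` to `ν`. -/
abbrev DominantChain (n : ℕ) (b t : ℕ → ℕ) (lam ν : YoungDiagram) : Type :=
  {g : Chain n b t // RowDom lam.rowLen g.val ∧
    ∀ k, lam.rowLen k + chainWt n g.val k = ν.rowLen k}

/-- Column dominance at `j = 0` says that `lam` plus the weight is a partition. Grouping the
surviving chains by it and applying the bialternant formula extracts the staircase alternant. -/
theorem alternant_mul_series_eq_sum {n : ℕ} {b t : ℕ → ℕ} {lam : YoungDiagram}
    (hlam : lam.colLen 0 ≤ n) (S : Finset YoungDiagram) (hS : ∀ ν ∈ S, ν.colLen 0 ≤ n)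
    (hmem : ∀ ν, Nonempty (DominantChain n b t lam ν) → ν ∈ S) :
    alternant (fun x : Fin n => lam.rowLen x + staircase n x) * Chain.series n b t =
      alternant (staircase n) *
        ∑ ν ∈ S, Nat.card (DominantChain n b t lam ν) • Chain.series n 0 ν.rowLen := by
  classical
  rw [Chain.alternant_mul_series_eq_sum_dominant (antitone_rowLen lam), Finset.mul_sum]
  have hex : ∀ g ∈ Finset.univ.filter fun g : Chain n b t => ColDom n lam.rowLen g.val,
      ∃ ν : YoungDiagram, ∀ k, ν.rowLen k = lam.rowLen k + chainWt n g.val k := by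
    intro g hg
    refine exists_rowLen_eq (n := n) (antitone_nat_of_succ_le fun k => ?_) fun k hk => ?_
    · simpa only [g.colCount_zero] using (Finset.mem_filter.1 hg).2 0 k
    · rw [rowLen_eq_zero (hlam.trans hk), g.chainWt_eq_zero hk]
  choose! shape hshape using hex
  rw [← Finset.sum_fiberwise_of_maps_to (g := shape) (t := S)]
  swap
  · intro g hg
    refine hmem _ ⟨⟨g, ?_, fun k => (hshape g hg k).symm⟩⟩
    exact (g.rowDom_iff_colDom _).2 (Finset.mem_filter.1 hg).2
  refine Finset.sum_congr rfl fun ν hν => ?_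
  rw [mul_smul_comm, Chain.alternant_mul_straight_series (antitone_rowLen ν)
    fun i hi => rowLen_eq_zero ((hS ν hν).trans hi), Nat.card_eq_fintype_card,
    Fintype.card_subtype]
  have hfib : (Finset.univ.filter fun g : Chain n b t => ColDom n lam.rowLen g.val).filter
      (fun g => shape g = ν) = Finset.univ.filter fun g : Chain n b t => RowDom lam.rowLen g.val ∧
        ∀ k, lam.rowLen k + chainWt n g.val k = ν.rowLen k := by
    ext g
    simp only [Finset.mem_filter, Finset.mem_univ, true_and, g.rowDom_iff_colDom]
    refine and_congr_right fun hg => ?_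
    have h1 := hshape g (Finset.mem_filter.2 ⟨Finset.mem_univ _, hg⟩)
    constructor
    · rintro rfl k
      exact (h1 k).symm
    · intro h2
      exact eq_of_rowLen fun k => (h1 k).trans (h2 k)
  rw [hfib]
  refine Finset.sum_eq_card_nsmul fun g hg => congrArg _ ?_
  funext x
  simp only [Chain.exponent, Chain.wt, Pi.add_apply, ← (Finset.mem_filter.1 hg).2.2 x]
  omega

theorem schur_eq_sum (χ : SkewShape) (S : Finset YoungDiagram)
    (hS : ∀ ν, (LR χ ν).Nonempty → ν ∈ S) :
    schur χ = ∑ ν ∈ S, (LR χ ν).ncard • schur (SkewShape.ofPartition ν) := by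
  refine eq_of_killCompl (max (χ.outer.colLen 0) (S.sup fun ν => ν.colLen 0)) fun n hn => ?_
  have hχ : χ.outer.colLen 0 ≤ n := (le_max_left _ _).trans hn
  have hSn : ∀ ν ∈ S, ν.colLen 0 ≤ n := fun ν hν =>
    (Finset.le_sup (f := fun ν : YoungDiagram => ν.colLen 0) hν).trans
      ((le_max_right _ _).trans hn)
  have hbot : (⊥ : YoungDiagram).colLen 0 ≤ n := by
    by_contra hc
    exact YoungDiagram.notMem_bot _ (YoungDiagram.mem_iff_lt_colLen.2 (not_le.1 hc))
  have e : ∀ ν, LR χ ν ≃ DominantChain n χ.inner.rowLen χ.outer.rowLen ⊥ ν := by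
    intro ν
    rw [DominantChain, rowLen_bot]
    exact LREquiv χ ν hχ
  have h := alternant_mul_series_eq_sum (b := χ.inner.rowLen) (t := χ.outer.rowLen) hbot S hSn
    fun ν ⟨g⟩ => hS ν ⟨_, ((e ν).symm g).2⟩
  simp only [rowLen_bot, Pi.zero_apply, zero_add] at h
  rw [killCompl_schur χ hχ, map_sum]
  refine (mul_left_cancel₀ alternant_staircase_ne_zero h).trans
    (Finset.sum_congr rfl fun ν hν => ?_)
  rw [map_nsmul, killCompl_schur_partition ν (hSn ν hν), ← Nat.card_congr (e ν),
    Nat.card_coe_set_eq]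

theorem schur_mul_schur_eq_sum (lam mu : YoungDiagram) (S : Finset YoungDiagram)
    (c : YoungDiagram → ℕ) (hc : ∀ ν (h : lam ≤ ν), c ν = (LR ⟨ν, lam, h⟩ mu).ncard)
    (hc' : ∀ ν, ¬ lam ≤ ν → c ν = 0)
    (hS : ∀ ν (h : lam ≤ ν), (LR ⟨ν, lam, h⟩ mu).Nonempty → ν ∈ S) :
    schur (SkewShape.ofPartition lam) * schur (SkewShape.ofPartition mu) =
      ∑ ν ∈ S, c ν • schur (SkewShape.ofPartition ν) := by
  refine eq_of_killCompl (max (max (lam.colLen 0) (mu.colLen 0)) (S.sup fun ν => ν.colLen 0))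
    fun n hn => ?_
  have hlam : lam.colLen 0 ≤ n := (le_max_left _ _).trans ((le_max_left _ _).trans hn)
  have hmu : mu.colLen 0 ≤ n := (le_max_right _ _).trans ((le_max_left _ _).trans hn)
  have hSn : ∀ ν ∈ S, ν.colLen 0 ≤ n := fun ν hν =>
    (Finset.le_sup (f := fun ν : YoungDiagram => ν.colLen 0) hν).trans
      ((le_max_right _ _).trans hn)
  have hsub : ∀ ν, Nonempty (DominantChain n 0 mu.rowLen lam ν) →
      lam ≤ ν ∧ ν.colLen 0 ≤ n := by
    rintro ν ⟨g⟩
    constructor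
    · rintro ⟨i, j⟩ hij
      have h1 := YoungDiagram.mem_iff_lt_rowLen.1 hij
      have h2 := g.2.2 i
      exact YoungDiagram.mem_iff_lt_rowLen.2 (by omega)
    · by_contra hcol
      have h1 := YoungDiagram.mem_iff_lt_rowLen.1
        (YoungDiagram.mem_iff_lt_colLen.2 (not_le.1 hcol))
      rw [← g.2.2 n, rowLen_eq_zero hlam, g.1.chainWt_eq_zero le_rfl] at h1
      omega
  -- The companion map exchanges shape and weight: from skew shape `ν/lam` and weight `mu` to shape
  -- `mu`, dominance relative to `lam` and total `ν`.
  have e : ∀ ν (h : lam ≤ ν), ν.colLen 0 ≤ n →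
      LR ⟨ν, lam, h⟩ mu ≃ DominantChain n 0 mu.rowLen lam ν := fun ν h hν =>
    (LREquiv ⟨ν, lam, h⟩ mu hν).trans
      (Chain.companionEquiv n 0 mu.rowLen lam.rowLen ν.rowLen
        (fun i hi => rowLen_eq_zero (hmu.trans hi))
        fun i hi => rowLen_eq_zero (hν.trans hi)).symm
  have h := alternant_mul_series_eq_sum (b := 0) (t := mu.rowLen) hlam S hSn fun ν hg =>
    hS ν (hsub ν hg).1 ⟨_, ((e ν (hsub ν hg).1 (hsub ν hg).2).symm hg.some).2⟩
  rw [← Chain.alternant_mul_straight_series (antitone_rowLen lam)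
    fun i hi => rowLen_eq_zero (hlam.trans hi), mul_assoc] at h
  rw [map_mul, killCompl_schur_partition lam hlam, killCompl_schur_partition mu hmu, map_sum]
  refine (mul_left_cancel₀ alternant_staircase_ne_zero h).trans
    (Finset.sum_congr rfl fun ν hν => ?_)
  rw [map_nsmul, killCompl_schur_partition ν (hSn ν hν)]
  congr 1
  by_cases hle : lam ≤ ν
  · rw [hc ν hle, ← Nat.card_congr (e ν hle (hSn ν hν)), Nat.card_coe_set_eq]
  · rw [hc' ν hle]
    exact @Nat.card_of_isEmpty _ ⟨fun g => hle (hsub ν ⟨g⟩).1⟩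

theorem schur_eq_finsum (χ : SkewShape) :
    schur χ = ∑ᶠ ν : YoungDiagram, (LR χ ν).ncard • schur (SkewShape.ofPartition ν) := by
  rw [finsum_eq_sum_of_support_subset _ (s := (finite_setOf_LR_nonempty χ).toFinset)]
  · exact schur_eq_sum χ _ fun ν hν => (Set.Finite.mem_toFinset _).2 hν
  · intro ν hν
    rw [Set.Finite.coe_toFinset]
    by_contra hne
    refine hν ?_
    have h0 : LR χ ν = ∅ := Set.not_nonempty_iff_eq_empty.1 hne
    simp only [h0, Set.ncard_empty, zero_smul]

theorem schur_mul_schur_eq_finsum (lam mu : YoungDiagram) :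
    schur (SkewShape.ofPartition lam) * schur (SkewShape.ofPartition mu) =
      ∑ᶠ (ν : YoungDiagram) (h : lam ≤ ν),
        (LR ⟨ν, lam, h⟩ mu).ncard • schur (SkewShape.ofPartition ν) := by
  classical
  let c : YoungDiagram → ℕ := fun ν => if h : lam ≤ ν then (LR ⟨ν, lam, h⟩ mu).ncard else 0
  have hc : ∀ ν (h : lam ≤ ν), c ν = (LR ⟨ν, lam, h⟩ mu).ncard := fun ν h => dif_pos h
  have hc' : ∀ ν, ¬ lam ≤ ν → c ν = 0 := fun ν h => dif_neg h
  have hterm : ∀ ν, ∑ᶠ h : lam ≤ ν, (LR ⟨ν, lam, h⟩ mu).ncard • schur (SkewShape.ofPartition ν) =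
      c ν • schur (SkewShape.ofPartition ν) := by
    intro ν
    by_cases h : lam ≤ ν
    · rw [hc ν h, finsum_eq_dif, dif_pos h]
    · rw [hc' ν h, zero_smul]
      have : IsEmpty (lam ≤ ν) := ⟨h⟩
      exact finsum_of_isEmpty _
  simp only [hterm]
  rw [finsum_eq_sum_of_support_subset _ (s := (finite_setOf_LR_skew_nonempty lam mu).toFinset)]
  · exact schur_mul_schur_eq_sum lam mu _ c hc hc' fun ν h hν =>
      (Set.Finite.mem_toFinset _).2 ⟨h, hν⟩
  · intro ν hν
    rw [Set.Finite.coe_toFinset]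
    by_contra hne
    refine hν ?_
    have h0 : c ν = 0 := by
      by_cases h : lam ≤ ν
      · rw [hc ν h, Set.not_nonempty_iff_eq_empty.1 fun hx => hne ⟨h, hx⟩, Set.ncard_empty]
      · exact hc' ν h
    simp only [h0, zero_smul]

end LRRule

open LRRule in
theorem mainTheorem2 :
    -- jeu de taquin preserves the property of being a Littlewood-Richardson tableau
    (∀ (χ χ' : SkewShape) (T : Tab χ) (T' : Tab χ'), SlidesTo T T' → (T.IsLR ↔ T'.IsLR)) ∧
    -- every tableau can be rectified
    (∀ (χ : SkewShape) (L : Tab χ),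
      ∃ (ν : YoungDiagram) (P : Tab (SkewShape.ofPartition ν)), SlidesTo L P) ∧
    -- a rectification is canonical exactly when one starts from a Littlewood-Richardson tableau,
    -- and its shape is then the weight of that tableau
    (∀ (χ : SkewShape) (L : Tab χ) (ν : YoungDiagram) (P : Tab (SkewShape.ofPartition ν)),
      SlidesTo L P →
        (L.IsLR ↔ P = canonical ν) ∧ (L.IsLR → ∀ k, L.wt k = ν.rowLen k)) ∧
    -- the fibre equation
    (∀ (χ : SkewShape) (ν : YoungDiagram), {L : Tab χ | SlidesTo L (canonical ν)} = LR χ ν) ∧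
    -- the Littlewood-Richardson rule for skew Schur functions
    (∀ χ : SkewShape,
      {ν : YoungDiagram | (LR χ ν).Nonempty}.Finite ∧
      (∀ ν : YoungDiagram, (LR χ ν).Finite) ∧
      schur χ =
        ∑ᶠ ν : YoungDiagram, (LR χ ν).ncard • schur (SkewShape.ofPartition ν)) ∧
    -- the Littlewood-Richardson rule for products of Schur functions
    (∀ lam mu : YoungDiagram,
      {ν : YoungDiagram | ∃ h : lam ≤ ν, (LR ⟨ν, lam, h⟩ mu).Nonempty}.Finite ∧
      schur (SkewShape.ofPartition lam) * schur (SkewShape.ofPartition mu) =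
        ∑ᶠ (ν : YoungDiagram) (h : lam ≤ ν),
          (LR ⟨ν, lam, h⟩ mu).ncard • schur (SkewShape.ofPartition ν)) := by
  refine ⟨fun χ χ' T T' h => h.invariants.1, fun χ L => exists_rectification L,
    fun χ L ν P h => ?_, setOf_slidesTo_canonical,
    fun χ => ⟨finite_setOf_LR_nonempty χ, finite_LR χ, schur_eq_finsum χ⟩,
    fun lam mu => ⟨finite_setOf_LR_skew_nonempty lam mu, schur_mul_schur_eq_finsum lam mu⟩⟩
  have hiff := h.invariants.1.trans (isLR_iff_eq_canonical P)
  refine ⟨hiff, fun hL k => ?_⟩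
  rw [h.invariants.2, hiff.1 hL, wt_canonical]
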